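/- Let $d\ge 1$ be an integer, $\alpha>0$ and $M=[\alpha]+1$, where $[\alpha]$ is the integer part of $\alpha$. Let $\phi,\psi:\mathbb R\to\mathbb R$ be functions of class $C^M$ whose derivatives of order $0,\dots,M$ all have fast decay (each is $O((1+|x|)^{-N})$ for every $N$). For $i\in\{0,1\}^d$ put $\psi^{(i)}(x)=\prod_{m=1}^d g_m(x_m)$ with $g_m=\psi$ if $i_m=1$ and $g_m=\phi$ if $i_m=0$. Suppose that $\phi,\psi$ generate a tensor product wavelet basis: the functions $\psi^{(0)}(x-k)$, $k\in\mathbb Z^d$, together with the functions $2^{dj/2}\psi^{(i)}(2^jx-k)$, $j\ge 0$, $i\in\{0,1\}^d\setminus\{0\}$, $k\in\mathbb Z^d$, form an orthonormal basis of $L^2(\mathbb R^d)$. For a bounded (Lebesgue measurable) function $f:\mathbb R^d\to\mathbb R$, define the wavelet coefficients $$c^{(i)}_{j,k}=2^{dj}\int_{\mathbb R^d}f(x)\,\psi^{(i)}(2^jx-k)\,dx,\qquad \|c_j\|_\infty=\sup_{i\in\{0,1\}^d\setminus\{0\}}\ \sup_{k\in\mathbb Z^d}|c^{(i)}_{j,k}|\qquad(j\ge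 0),$$ and, with $\Delta_hf(x)=f(x+h)-f(x)$ and $\Delta_h^n$ its $n$-th iterate, the moduli of smoothness $\omega_f^n(r)=\sup_{|h|\le r}\sup_{x\in\mathbb R^d}|\Delta_h^nf(x)|$. For $\beta\in\mathbb R$ write $f\in UI^\alpha_\beta(\mathbb R^d)$ if there are $C,R>0$ with $\omega_f^M(r)\ge C\,r^\alpha|\log r|^\beta$ for all $0<r\le R$, and $UI^\alpha(\mathbb R^d)=UI^\alpha_0(\mathbb R^d)$. Call $f$ uniformly Hölder if for some $s>0$ there are $C,R>0$ with $\omega_f^{[s]+1}(r)\le C r^s$ for all $0<r\le R$. Theorem. Let $f:\mathbb R^d\to\mathbb R$ be bounded. If there exists $C>0$ such that for every integer $j\ge 0$ $$\max\Big(\sup_{\ell\ge j}\|c_\ell\|_\infty,\ 2^{-jM}\sup_{0\le\ell\le j}2^{\ell M}\|c_\ell\|_\infty\Big)\ \ge\ C\,2^{-j\alpha},\qquad(*)$$ then $f\in UI^\alpha(\mathbb R^d)$. Conversely, if $f$ is uniformly Hölder and $f\in UI^\alpha_\beta(\mathbb R^d)$ for every $\beta>1$, then there exists $C>0$ such that $(*)$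 holds for every integer $j\ge 0$. -/

import Mathlib

open MeasureTheory

/-- The order `M = [α] + 1` of the finite differences associated with the exponent `α`. -/
noncomputable def diffOrder (α : ℝ) : ℕ := ⌊α⌋₊ + 1

/-- The `M`-modulus of smoothness
`ω_f^M (r) = sup_{|h| ≤ r} sup_x |Δ_h^M f (x)|`, where `Δ_h^M` is the `M`-th iterate of the
forward difference `Δ_h f (x) = f (x + h) - f x` (it is only used for bounded `f` and `r > 0`,
so that the suprema are finite and over nonempty sets). -/
noncomputable def modulusOfSmoothness {d : ℕ} (M : ℕ) (f : EuclideanSpace ℝ (Fin d) → ℝ)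
    (r : ℝ) : ℝ :=
  ⨆ h : Metric.closedBall (0 : EuclideanSpace ℝ (Fin d)) r,
    ⨆ x : EuclideanSpace ℝ (Fin d), |((fwdDiff (h : EuclideanSpace ℝ (Fin d)))^[M] f) x|

/-- Membership of a bounded function in `C^α_β(ℝ^d)`. -/
def MemHolderBeta {d : ℕ} (α β : ℝ) (f : EuclideanSpace ℝ (Fin d) → ℝ) : Prop :=
  ∃ C > 0, ∃ R > 0, ∀ r : ℝ, 0 < r → r ≤ R →
    modulusOfSmoothness (diffOrder α) f r ≤ C * r ^ α * |Real.log r| ^ β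

/-- A bounded function is uniformly Hölder if it belongs to `C^s(ℝ^d) = C^s_0(ℝ^d)` for some
`s > 0`. -/
def IsUniformlyHolder {d : ℕ} (f : EuclideanSpace ℝ (Fin d) → ℝ) : Prop :=
  ∃ s > 0, MemHolderBeta s 0 f

/-- Membership of a bounded function in `UI^α_β(ℝ^d)`; the class `UI^α(ℝ^d)` is the case
`β = 0`. -/
def MemUI {d : ℕ} (α β : ℝ) (f : EuclideanSpace ℝ (Fin d) → ℝ) : Prop :=
  ∃ C > 0, ∃ R > 0, ∀ r : ℝ, 0 < r → r ≤ R →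
    C * r ^ α * |Real.log r| ^ β ≤ modulusOfSmoothness (diffOrder α) f r

/-- The functions `x ↦ Ψ^{(i)} (2^j x - k)`, where
`Ψ^{(i)} (x) = ∏ m, (ψ (x m) if i m = 1, φ (x m) if i m = 0)` is the tensor product function of
type `i ∈ {0,1}^d`. The type `i = 0` gives the scaling function `φ ⊗ ⋯ ⊗ φ`, the other types give
the `2^d - 1` wavelets. -/
noncomputable def tensorWavelet {d : ℕ} (φ ψ : ℝ → ℝ) (i : Fin d → Bool) (j : ℕ) (k : Fin d → ℤ)
    (x : EuclideanSpace ℝ (Fin d)) : ℝ :=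
  ∏ m, (if i m then ψ else φ) (2 ^ j * x m - k m)

/-- The types `{0,1}^d ∖ {0}` of the wavelets. -/
abbrev WaveletType (d : ℕ) : Type := {i : Fin d → Bool // i ≠ fun _ => false}

/-- Indices of the basis: `k` for the translates of the scaling function at scale `0`, and
`(j, i, k)` with `j ≥ 0` for the wavelets. -/
abbrev WaveletIndex (d : ℕ) : Type :=
  (Fin d → ℤ) ⊕ (ℕ × WaveletType d × (Fin d → ℤ))

/-- The basis functions in `L²` normalisation: `φ ⊗ ⋯ ⊗ φ (x - k)` and
`2^{dj/2} ψ^{(i)} (2^j x - k)`. -/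
noncomputable def waveletFamily {d : ℕ} (φ ψ : ℝ → ℝ) :
    WaveletIndex d → EuclideanSpace ℝ (Fin d) → ℝ
  | Sum.inl k => tensorWavelet φ ψ (fun _ => false) 0 k
  | Sum.inr (j, i, k) => fun x => √(2 ^ (d * j)) * tensorWavelet φ ψ i.1 j k x

/-- All derivatives of `g` up to the order `M` have fast decay. -/
def FastDecay (M : ℕ) (g : ℝ → ℝ) : Prop :=
  ∀ s ≤ M, ∀ N : ℕ, ∃ K : ℝ, ∀ x : ℝ, (1 + |x|) ^ N * |iteratedDeriv s g x| ≤ K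

/-- `φ` and `ψ` generate a tensor product wavelet basis of `L²(ℝ^d)` of class `C^M`, with fast
decay of the derivatives up to the order `M`. -/
structure IsWaveletBasis (d M : ℕ) (φ ψ : ℝ → ℝ) : Prop where
  contDiff_scaling : ContDiff ℝ M φ
  contDiff_wavelet : ContDiff ℝ M ψ
  decay_scaling : FastDecay M φ
  decay_wavelet : FastDecay M ψ
  isBasis : ∃ b : HilbertBasis (WaveletIndex d) ℝ
      (Lp ℝ 2 (volume : Measure (EuclideanSpace ℝ (Fin d)))),
    ∀ n, ⇑(b n) =ᵐ[volume] waveletFamily φ ψ n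

/-- The wavelet coefficients in `L^∞` normalisation,
`c_{j,k}^{(i)} = 2^{dj} ∫ f(x) ψ^{(i)} (2^j x - k) dx`. -/
noncomputable def waveletCoeff {d : ℕ} (φ ψ : ℝ → ℝ) (f : EuclideanSpace ℝ (Fin d) → ℝ)
    (i : WaveletType d) (j : ℕ) (k : Fin d → ℤ) : ℝ :=
  2 ^ (d * j) * ∫ x, f x * tensorWavelet φ ψ i.1 j k x

/-- `‖c_{j,·}^{(·)}‖_∞ = sup_i sup_k |c_{j,k}^{(i)}|`. -/
noncomputable def coeffSup {d : ℕ} (φ ψ : ℝ → ℝ) (f : EuclideanSpace ℝ (Fin d) → ℝ)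
    (j : ℕ) : ℝ :=
  ⨆ i : WaveletType d, ⨆ k : Fin d → ℤ, |waveletCoeff φ ψ f i j k|

/-- There is `C > 0` such that, for all integers `j ≥ 0`,
`max (sup_{ℓ ≥ j} ‖c_ℓ‖_∞, 2^{-jM} sup_{ℓ ≤ j} 2^{ℓM} ‖c_ℓ‖_∞) ≥ C 2^{-jα}`, with
`M = [α] + 1` and `ℓ ≥ 0`. -/
def WaveletLowerBound {d : ℕ} (α : ℝ) (φ ψ : ℝ → ℝ) (f : EuclideanSpace ℝ (Fin d) → ℝ) : Prop :=
  ∃ C > 0, ∀ j : ℕ,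
    C * (2 : ℝ) ^ (-(j : ℝ) * α) ≤
      max (⨆ l : Set.Ici j, coeffSup φ ψ f l)
        (((2 : ℝ) ^ (j * diffOrder α))⁻¹ *
          ⨆ l : Set.Iic j, (2 : ℝ) ^ ((l : ℕ) * diffOrder α) * coeffSup φ ψ f l)

/-!
Both implications compare the modulus of smoothness `ω (2^{-j})` of order `M` with the suprema
`‖c_l‖` of the wavelet coefficients.

For the first implication one needs `‖c_l‖ ≤ C ω (2^{-l})`
(`IsWaveletBasis.exists_abs_waveletCoeff_le`). Orthogonality of `ψ` to its finer dilates, together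
with its smoothness, makes `ψ` the `M`-th derivative of a rapidly decreasing function `Θ`
(`primitive_properties`). Correlating `f` with `ψ` along a coordinate axis gives a function
`G 0 = (G M)^{(M)}` of one variable, where `G M` comes from `Θ`; the differences of order `M` of
`G 0` and `G M` are controlled by those of `f`, and Steklov averages bound `G 0` by these
differences (`abs_le_of_abs_fwdDiff_iter_le`). Since `ω (2^n r) ≤ 2^{nM} ω (r)`, both suprema in the
wavelet condition at scale `j` are at most a multiple of `ω (2^{-j})`.

For the converse, `ω (r)` is at most a multiple of `‖f‖_∞ r^M + ∑_l ‖c_l‖ min (1, (2^l r)^M)` for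
`f` continuous (`IsWaveletBasis.exists_modulusOfSmoothness_le`). This is obtained by duality: a
bounded `f` is paired with `Δ_{-h}^M θ`, for a bump function `θ`, whose wavelet series converges in
`L¹`, so that Parseval's identity extends to the pair
(`IsWaveletBasis.integral_mul_eq_tsum`), and the `ℓ¹` norm of the coefficients of `Δ_{-h}^M θ` at
each scale is at most a multiple of `min (1, (2^l |h|)^M)` times the `L¹` norm of `θ`
(`IsWaveletBasis.exists_tsum_enorm_fwdDiff_le`). A uniformly Hölder function is continuous with
geometrically decreasing `‖c_l‖`, by Marchaud's inequality and the first bound. Hence only `O(j)`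
scales matter in `ω (2^{-j})`, each contributing at most the maximum `X_j` in the wavelet condition:
`ω (2^{-j}) ≤ C (2^{-jα} + j X_j)`. A lower bound `ω (2^{-j}) ≥ c 2^{-jα} j^β` with `β > 1` forces
`X_j ≥ 2^{-jα}` for large `j`; and `X_j` never vanishes, since otherwise every coefficient would.
-/

/-! ### Finite differences -/

theorem abs_fwdDiff_iter_le {E : Type*} [AddCommGroup E] {f : E → ℝ} {B : ℝ}
    (hf : ∀ x, |f x| ≤ B) (h : E) (n : ℕ) (x : E) : |((fwdDiff h)^[n] f) x| ≤ 2 ^ n * B := by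
  induction n generalizing f B with
  | zero => simpa using hf x
  | succ n ih =>
    rw [Function.iterate_succ_apply]
    have h2 : ∀ x, |fwdDiff h f x| ≤ 2 * B := fun x => by
      have h1 := abs_sub (f (x + h)) (f x)
      have h3 := hf (x + h)
      have h4 := hf x
      simp only [fwdDiff]
      linarith
    calc _ ≤ 2 ^ n * (2 * B) := ih h2
      _ = _ := by ring

theorem fwdDiff_iter_comp {E F : Type*} [AddCommGroup E] [AddCommGroup F] {g : E → F} {h : E}
    {h' : F} (hg : ∀ x, g (x + h) = g x + h') (f : F → ℝ) (n : ℕ) (x : E) :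
    ((fwdDiff h)^[n] fun x => f (g x)) x = ((fwdDiff h')^[n] f) (g x) := by
  induction n generalizing f with
  | zero => rfl
  | succ n ih =>
    rw [Function.iterate_succ_apply, Function.iterate_succ_apply, ← ih]
    have e : (fwdDiff h fun x => f (g x)) = fun x => fwdDiff h' f (g x) := by
      funext x
      simp [fwdDiff, hg]
    rw [e]

theorem fwdDiff_iter_mul_const {E : Type*} [AddCommGroup E] (f : E → ℝ) (c : ℝ) (h : E) (n : ℕ)
    (x : E) : ((fwdDiff h)^[n] fun x => f x * c) x = ((fwdDiff h)^[n] f) x * c := by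
  have := congrFun (fwdDiff_iter_const_smul (h := h) c f n) x
  have e : (fun x => f x * c) = c • f := by funext x; simp [mul_comm]
  rw [e, this]; simp [mul_comm]

theorem continuous_fwdDiff_iter {E : Type*} [AddCommGroup E] [TopologicalSpace E]
    [ContinuousAdd E] {f : E → ℝ} (hf : Continuous f) (h : E) (n : ℕ) :
    Continuous ((fwdDiff h)^[n] f) := by
  induction n generalizing f with
  | zero => exact hf
  | succ n ih =>
    rw [Function.iterate_succ_apply]
    apply ih
    unfold fwdDiff
    fun_prop

/-- The operator `1 + τ_h`, where `τ_h` is the translation by `h`; it factors the difference of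
step `2h` as `Δ_{2h} = (1 + τ_h) Δ_h`. -/
def addShift {E : Type*} [AddCommGroup E] (h : E) (g : E → ℝ) : E → ℝ := fun x => g (x + h) + g x

theorem fwdDiff_iter_two_step {E : Type*} [AddCommGroup E] (f : E → ℝ) (h : E) (n : ℕ) :
    (fwdDiff (h + h))^[n] f = (addShift h)^[n] ((fwdDiff h)^[n] f) := by
  have e : fwdDiff (h + h) = addShift h ∘ (fwdDiff h : (E → ℝ) → E → ℝ) := by
    funext f x
    simp only [fwdDiff, addShift, Function.comp, add_assoc]
    ring
  have c : Function.Commute (addShift h) (fwdDiff h : (E → ℝ) → E → ℝ) := by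
    intro f
    funext x
    simp only [fwdDiff, addShift]
    ring
  rw [e, c.comp_iterate]
  rfl

theorem abs_addShift_iter_le {E : Type*} [AddCommGroup E] {g : E → ℝ} {A : ℝ}
    (hg : ∀ x, |g x| ≤ A) (h : E) (n : ℕ) (x : E) : |((addShift h)^[n] g) x| ≤ 2 ^ n * A := by
  induction n generalizing g A with
  | zero => simpa using hg x
  | succ n ih =>
    rw [Function.iterate_succ_apply]
    have h2 : ∀ x, |addShift h g x| ≤ 2 * A := fun x => by
      have h1 := abs_add_le (g (x + h)) (g x)
      have h3 := hg (x + h)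
      have h4 := hg x
      simp only [addShift]
      linarith
    calc _ ≤ 2 ^ n * (2 * A) := ih h2
      _ = _ := by ring

theorem abs_fwdDiff_iter_two_step_le {E : Type*} [AddCommGroup E] {f : E → ℝ} {A : ℝ} {h : E}
    {n : ℕ} (hf : ∀ x, |((fwdDiff h)^[n] f) x| ≤ A) (x : E) :
    |((fwdDiff (h + h))^[n] f) x| ≤ 2 ^ n * A := by
  rw [fwdDiff_iter_two_step]
  exact abs_addShift_iter_le hf h n x

theorem abs_addShift_iter_sub_le {E : Type*} [AddCommGroup E] {g : E → ℝ} {ε : ℝ} {h : E}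
    (hg : ∀ x, |fwdDiff h g x| ≤ ε) (n : ℕ) (x : E) :
    |((addShift h)^[n] g) x - 2 ^ n * g x| ≤ n * 2 ^ n * ε := by
  induction n generalizing x with
  | zero => simp
  | succ n ih =>
    have h1 := ih x
    have h2 := ih (x + h)
    have h3 : |2 ^ n * fwdDiff h g x| ≤ 2 ^ n * ε := by
      rw [abs_mul, abs_of_pos (by positivity : (0 : ℝ) < 2 ^ n)]
      exact mul_le_mul_of_nonneg_left (hg x) (by positivity)
    have h4 : 0 ≤ 2 ^ n * ε :=
      mul_nonneg (by positivity) ((abs_nonneg _).trans (hg x))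
    rw [Function.iterate_succ_apply']
    have e : addShift h ((addShift h)^[n] g) x - 2 ^ (n + 1) * g x
        = (((addShift h)^[n] g) (x + h) - 2 ^ n * g (x + h))
          + (((addShift h)^[n] g) x - 2 ^ n * g x) + 2 ^ n * fwdDiff h g x := by
      simp only [addShift, fwdDiff]
      ring
    rw [e]
    refine (abs_add_three _ _ _).trans ?_
    push_cast
    rw [pow_succ]
    linarith

/-- One step of Marchaud's inequality: differences of order `n` are recovered from differences of
double step up to differences of order `n + 1`. -/
theorem abs_fwdDiff_iter_le_two_step {E : Type*} [AddCommGroup E] {f : E → ℝ} {ε A : ℝ} {h : E}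
    {n : ℕ} (hf : ∀ x, |((fwdDiff h)^[n + 1] f) x| ≤ ε)
    (hA : ∀ x, |((fwdDiff (h + h))^[n] f) x| ≤ A) (x : E) :
    |((fwdDiff h)^[n] f) x| ≤ (2 ^ n)⁻¹ * A + n * ε := by
  have h1 := abs_addShift_iter_sub_le (g := (fwdDiff h)^[n] f) (h := h) (ε := ε)
    (fun x => by rw [← Function.iterate_succ_apply' (fwdDiff h) n f]; exact hf x) n x
  rw [← fwdDiff_iter_two_step] at h1
  have h2 := hA x
  have hp : (0 : ℝ) < 2 ^ n := by positivity
  have h3 : |2 ^ n * ((fwdDiff h)^[n] f) x| ≤ A + n * 2 ^ n * ε := by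
    rw [abs_sub_comm] at h1
    have := abs_add_le (2 ^ n * ((fwdDiff h)^[n] f) x - ((fwdDiff (h + h))^[n] f) x)
      (((fwdDiff (h + h))^[n] f) x)
    rw [sub_add_cancel] at this
    linarith
  rw [abs_mul, abs_of_pos hp] at h3
  calc _ = (2 ^ n)⁻¹ * (2 ^ n * |((fwdDiff h)^[n] f) x|) := by field_simp
    _ ≤ (2 ^ n)⁻¹ * (A + n * 2 ^ n * ε) := by gcongr
    _ = _ := by field_simp

/-- Marchaud's inequality for Hölder bounds: for exponents `t < n`, a Hölder bound on the
differences of order `n + 1` of a bounded function gives one on the differences of order `n`. -/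
theorem abs_fwdDiff_iter_le_of_succ {E : Type*} [NormedAddCommGroup E] [NormedSpace ℝ E]
    {f : E → ℝ} {B C t : ℝ} {n : ℕ} (hB : ∀ x, |f x| ≤ B) (hn : 0 < n)
    (htn : t < n)
    (hC : ∀ h x, |((fwdDiff h)^[n + 1] f) x| ≤ C * ‖h‖ ^ t) :
    ∃ K, ∀ h x, |((fwdDiff h)^[n] f) x| ≤ K * ‖h‖ ^ t := by
  set q : ℝ := (2 : ℝ) ^ t * (2 ^ n)⁻¹ with hq
  have hq1 : q < 1 := by
    rw [hq, ← div_eq_mul_inv, div_lt_one (by positivity), ← Real.rpow_natCast 2 n]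
    exact Real.rpow_lt_rpow_of_exponent_lt (by norm_num) htn
  set K : ℝ := n * C / (1 - q) with hK
  have hKq : q * K + n * C = K := by
    have : 1 - q ≠ 0 := by linarith
    rw [hK]; field_simp; ring
  refine ⟨max K 0, fun h x => ?_⟩
  have key : ∀ N : ℕ, ∀ h x, |((fwdDiff h)^[n] f) x|
      ≤ ((2 ^ n)⁻¹) ^ N * (2 ^ n * B) + max K 0 * ‖h‖ ^ t := by
    intro N
    induction N with
    | zero =>
      intro h x
      have := abs_fwdDiff_iter_le hB h n x
      have h2 : 0 ≤ max K 0 * ‖h‖ ^ t := by positivity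
      simpa using by linarith
    | succ N ih =>
      intro h x
      refine (abs_fwdDiff_iter_le_two_step (hC h) (ih (h + h)) x).trans ?_
      have e : ‖h + h‖ ^ t = (2 : ℝ) ^ t * ‖h‖ ^ t := by
        rw [← two_smul ℝ h, norm_smul, Real.norm_eq_abs, abs_of_pos (by norm_num),
          Real.mul_rpow (by norm_num) (norm_nonneg _)]
      rw [e]
      have hh : 0 ≤ ‖h‖ ^ t := by positivity
      have hq0 : 0 ≤ q := by positivity
      have h1 : q * max K 0 + n * C ≤ max K 0 := by
        rcases le_total 0 K with h0 | h0
        · rw [max_eq_left h0, hKq]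
        · rw [max_eq_right h0]
          nlinarith
      calc _ = ((2 ^ n)⁻¹) ^ (N + 1) * (2 ^ n * B) + (q * max K 0 + n * C) * ‖h‖ ^ t := by
            rw [hq]; ring
        _ ≤ _ := by gcongr
  have hlim : Filter.Tendsto (fun N : ℕ => (((2 : ℝ) ^ n)⁻¹) ^ N * (2 ^ n * B) +
      max K 0 * ‖h‖ ^ t) Filter.atTop (nhds (0 * (2 ^ n * B) + max K 0 * ‖h‖ ^ t)) := by
    refine ((tendsto_pow_atTop_nhds_zero_of_lt_one (by positivity) ?_).mul_const _).add_const _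
    exact inv_lt_one_of_one_lt₀ (one_lt_pow₀ (by norm_num) hn.ne')
  have := ge_of_tendsto' hlim fun N => key N h x
  simpa using this

/-! ### The modulus of smoothness of a bounded function -/

theorem bddAbove_abs_fwdDiff {d : ℕ} {f : EuclideanSpace ℝ (Fin d) → ℝ} {B : ℝ}
    (hf : ∀ x, |f x| ≤ B) (M : ℕ) (h : EuclideanSpace ℝ (Fin d)) :
    BddAbove (Set.range fun x => |((fwdDiff h)^[M] f) x|) :=
  ⟨2 ^ M * B, by rintro _ ⟨x, rfl⟩; exact abs_fwdDiff_iter_le hf h M x⟩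

theorem abs_fwdDiff_iter_le_modulusOfSmoothness {d : ℕ} {f : EuclideanSpace ℝ (Fin d) → ℝ} {B : ℝ}
    (hf : ∀ x, |f x| ≤ B) (M : ℕ) {h : EuclideanSpace ℝ (Fin d)} {r : ℝ} (hr : ‖h‖ ≤ r)
    (x : EuclideanSpace ℝ (Fin d)) :
    |((fwdDiff h)^[M] f) x| ≤ modulusOfSmoothness M f r := by
  refine (le_ciSup (bddAbove_abs_fwdDiff hf M h) x).trans ?_
  refine le_ciSup (f := fun h : Metric.closedBall (0 : EuclideanSpace ℝ (Fin d)) r =>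
    ⨆ x, |((fwdDiff (h : EuclideanSpace ℝ (Fin d)))^[M] f) x|) ?_ ⟨h, by simpa using hr⟩
  refine ⟨2 ^ M * B, ?_⟩
  rintro _ ⟨h, rfl⟩
  exact ciSup_le fun x => abs_fwdDiff_iter_le hf _ M x

theorem modulusOfSmoothness_le {d : ℕ} {f : EuclideanSpace ℝ (Fin d) → ℝ} {M : ℕ} {r A : ℝ}
    (hA : 0 ≤ A) (h : ∀ h : EuclideanSpace ℝ (Fin d), ‖h‖ ≤ r → ∀ x,
      |((fwdDiff h)^[M] f) x| ≤ A) : modulusOfSmoothness M f r ≤ A :=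
  Real.iSup_le (fun i => Real.iSup_le (h i (mem_closedBall_zero_iff.1 i.2)) hA) hA

theorem modulusOfSmoothness_nonneg {d : ℕ} (f : EuclideanSpace ℝ (Fin d) → ℝ) (M : ℕ) (r : ℝ) :
    0 ≤ modulusOfSmoothness M f r :=
  Real.iSup_nonneg fun _ => Real.iSup_nonneg fun _ => abs_nonneg _

theorem modulusOfSmoothness_mono {d : ℕ} {f : EuclideanSpace ℝ (Fin d) → ℝ} {B : ℝ}
    (hf : ∀ x, |f x| ≤ B) (M : ℕ) {r r' : ℝ} (hr : r ≤ r') :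
    modulusOfSmoothness M f r ≤ modulusOfSmoothness M f r' :=
  modulusOfSmoothness_le (modulusOfSmoothness_nonneg _ _ _) fun _ hh x =>
    abs_fwdDiff_iter_le_modulusOfSmoothness hf M (hh.trans hr) x

theorem modulusOfSmoothness_two_pow_mul_le {d : ℕ} {f : EuclideanSpace ℝ (Fin d) → ℝ} {B : ℝ}
    (hf : ∀ x, |f x| ≤ B) (M n : ℕ) (r : ℝ) :
    modulusOfSmoothness M f (2 ^ n * r) ≤ 2 ^ (n * M) * modulusOfSmoothness M f r := by
  induction n with
  | zero => simp
  | succ n ih =>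
    have h2 : modulusOfSmoothness M f (2 ^ (n + 1) * r)
        ≤ 2 ^ M * modulusOfSmoothness M f (2 ^ n * r) := by
      refine modulusOfSmoothness_le
        (mul_nonneg (by positivity) (modulusOfSmoothness_nonneg _ _ _)) fun h hh x => ?_
      have e : h = (2 : ℝ)⁻¹ • h + (2 : ℝ)⁻¹ • h := by
        rw [← add_smul]; norm_num
      rw [e]
      refine abs_fwdDiff_iter_two_step_le (fun x =>
        abs_fwdDiff_iter_le_modulusOfSmoothness hf M ?_ x) x
      rw [norm_smul, norm_inv, Real.norm_two]
      rw [pow_succ] at hh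
      linarith
    calc _ ≤ 2 ^ M * (2 ^ (n * M) * modulusOfSmoothness M f r) := h2.trans (by gcongr)
      _ = _ := by rw [add_mul, pow_add]; ring

/-- A bounded uniformly Hölder function satisfies a Hölder condition in the usual sense, by
descending Marchaud's inequality to differences of order one. -/
theorem IsUniformlyHolder.exists_fwdDiff_le {d : ℕ} {f : EuclideanSpace ℝ (Fin d) → ℝ} {B : ℝ}
    (hf : ∀ x, |f x| ≤ B) (h : IsUniformlyHolder f) :
    ∃ t : ℝ, 0 < t ∧ ∃ K, ∀ h x, |fwdDiff h f x| ≤ K * ‖h‖ ^ t := by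
  obtain ⟨s, hs, C, hC, R, hR, hω⟩ := h
  set t : ℝ := min s (1 / 2) with ht
  have ht0 : 0 < t := lt_min hs (by norm_num)
  have ht1 : t < 1 := (min_le_right _ _).trans_lt (by norm_num)
  have hB0 : 0 ≤ B := (abs_nonneg _).trans (hf 0)
  refine ⟨t, ht0, ?_⟩
  set ρ : ℝ := min R 1 with hρ
  have hρ0 : 0 < ρ := lt_min hR one_pos
  -- large steps are controlled by the bound on `f` alone
  have h0 : ∃ K, ∀ h x, |((fwdDiff h)^[diffOrder s] f) x| ≤ K * ‖h‖ ^ t := by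
    refine ⟨C + 2 ^ diffOrder s * B / ρ ^ t, fun h x => ?_⟩
    rw [add_mul]
    rcases eq_or_ne h 0 with rfl | hh
    · have e : (fwdDiff (0 : EuclideanSpace ℝ (Fin d)))^[diffOrder s] f = fun _ => 0 := by
        rw [diffOrder, Function.iterate_succ_apply']
        funext x
        simp [fwdDiff]
      rw [e]
      simp only [abs_zero]
      positivity
    have hh0 : 0 < ‖h‖ := norm_pos_iff.2 hh
    rcases le_total ‖h‖ ρ with h1 | h1
    · have h2 := hω ‖h‖ hh0 (h1.trans (min_le_left _ _))
      rw [Real.rpow_zero, mul_one] at h2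
      have h3 : ‖h‖ ^ s ≤ ‖h‖ ^ t :=
        Real.rpow_le_rpow_of_exponent_ge hh0 (h1.trans (min_le_right _ _)) (min_le_left _ _)
      have h4 := abs_fwdDiff_iter_le_modulusOfSmoothness hf (diffOrder s) le_rfl (h := h) x
      have h5 : 0 ≤ 2 ^ diffOrder s * B / ρ ^ t * ‖h‖ ^ t := by positivity
      have h6 : C * ‖h‖ ^ s ≤ C * ‖h‖ ^ t := by gcongr
      linarith
    · have h2 : ρ ^ t ≤ ‖h‖ ^ t := Real.rpow_le_rpow hρ0.le h1 ht0.le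
      have h3 : 2 ^ diffOrder s * B ≤ 2 ^ diffOrder s * B / ρ ^ t * ‖h‖ ^ t := by
        rw [div_mul_eq_mul_div, le_div_iff₀ (by positivity)]
        gcongr
      have h4 := abs_fwdDiff_iter_le hf h (diffOrder s) x
      have h5 : 0 ≤ C * ‖h‖ ^ t := by positivity
      linarith
  have h1 : ∀ n : ℕ, (∃ K, ∀ h x, |((fwdDiff h)^[n + 1] f) x| ≤ K * ‖h‖ ^ t) →
      ∃ K, ∀ h x, |((fwdDiff h)^[1] f) x| ≤ K * ‖h‖ ^ t := by
    intro n
    induction n with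
    | zero => exact id
    | succ n ih =>
      rintro ⟨K, hK⟩
      refine ih (abs_fwdDiff_iter_le_of_succ hf (Nat.succ_pos n) ?_ hK)
      push_cast
      have : (0 : ℝ) ≤ n := by positivity
      linarith
  exact h1 _ h0

/-! ### Differences and derivatives in one variable -/

theorem hasDerivAt_fwdDiff_iter {u u' : ℝ → ℝ} (hu : ∀ t, HasDerivAt u (u' t) t) (δ : ℝ) (n : ℕ)
    (t : ℝ) : HasDerivAt ((fwdDiff δ)^[n] u) (((fwdDiff δ)^[n] u') t) t := by
  induction n generalizing u u' with
  | zero => exact hu t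
  | succ n ih =>
    rw [Function.iterate_succ_apply, Function.iterate_succ_apply]
    refine ih fun t => ?_
    exact ((hu (t + δ)).comp_add_const t δ).sub (hu t)

theorem abs_fwdDiff_iter_le_of_hasDerivAt {n : ℕ} {u : ℕ → ℝ → ℝ}
    (hu : ∀ i < n, ∀ t, HasDerivAt (u i) (u (i + 1) t) t) {A δ x : ℝ} (hδ : 0 ≤ δ)
    (hA : ∀ t ∈ Set.Icc x (x + n * δ), |u n t| ≤ A) :
    |((fwdDiff δ)^[n] (u 0)) x| ≤ δ ^ n * A := by
  induction n generalizing u x with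
  | zero => simpa using hA x (by simp)
  | succ n ih =>
    rw [Function.iterate_succ_apply']
    have hd : ∀ t, HasDerivAt ((fwdDiff δ)^[n] (u 0)) (((fwdDiff δ)^[n] (u 1)) t) t :=
      hasDerivAt_fwdDiff_iter (hu 0 n.succ_pos) δ n
    have hb : ∀ t ∈ Set.Icc x (x + δ), ‖((fwdDiff δ)^[n] (u 1)) t‖ ≤ δ ^ n * A := by
      intro t ht
      refine ih (u := fun i => u (i + 1)) (fun i hi => hu (i + 1) (by omega)) fun s hs => hA s ?_
      push_cast
      exact ⟨ht.1.trans hs.1, by linarith [hs.2, ht.2]⟩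
    have := (convex_Icc x (x + δ)).norm_image_sub_le_of_norm_hasDerivWithin_le
      (fun t _ => (hd t).hasDerivWithinAt) hb (Set.left_mem_Icc.2 (by linarith))
      (Set.right_mem_Icc.2 (by linarith))
    rw [Real.norm_eq_abs, Real.norm_eq_abs, add_sub_cancel_left, abs_of_nonneg hδ] at this
    calc _ ≤ δ ^ n * A * δ := this
      _ = _ := by ring

/-- A function is controlled by its own differences of order `n` together with those of an
antiderivative `G n` of order `n`. This is the Steklov averaging argument: averaging
`∑ₖ (-1)ⁿ⁻ᵏ (n choose k) F (x + k s) = Δ_sⁿ F x` over `s = s₁ + ⋯ + sₙ`, `sᵢ ∈ [0, 1]`, turns each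
term with `k ≥ 1` into `k⁻ⁿ Δ_kⁿ (G n) x`. -/
theorem abs_le_of_abs_fwdDiff_iter_le {n : ℕ} {G : ℕ → ℝ → ℝ} (h0 : Continuous (G 0))
    (hG : ∀ i < n, ∀ t, HasDerivAt (G (i + 1)) (G i t) t) {ε : ℝ}
    (hF : ∀ s ∈ Set.Icc (0 : ℝ) n, ∀ x, |((fwdDiff s)^[n] (G 0)) x| ≤ ε)
    (hGn : ∀ s ∈ Set.Icc (0 : ℝ) n, ∀ x, |((fwdDiff s)^[n] (G n)) x| ≤ ε) (x : ℝ) :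
    |G 0 x| ≤ 2 ^ n * ε := by
  have hε : 0 ≤ ε := (abs_nonneg _).trans (hF 0 (by simp) 0)
  -- `J i k` is the `i`-fold average of `t ↦ G 0 (x + k t)`
  let J : ℕ → ℕ → ℝ → ℝ := fun i k x =>
    if k = 0 then G 0 x else ((k : ℝ) ^ i)⁻¹ * ((fwdDiff (k : ℝ))^[i] (G i)) x
  have hcont : ∀ i ≤ n, Continuous (G i) := by
    intro i hi
    rcases i with _ | i
    · exact h0
    · exact continuous_iff_continuousAt.2 fun t => (hG i hi t).continuousAt
  have hJc : ∀ i ≤ n, ∀ k, Continuous (J i k) := by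
    intro i hi k
    by_cases hk : k = 0
    · simpa [J, hk] using h0
    · simp only [J, hk, if_false]
      exact continuous_const.mul (continuous_fwdDiff_iter (hcont i hi) _ _)
  have hJ : ∀ i < n, ∀ k x, ∫ t in (0 : ℝ)..1, J i k (x + k * t) = J (i + 1) k x := by
    intro i hi k x
    by_cases hk : k = 0
    · simp [J, hk]
    have hk0 : (k : ℝ) ≠ 0 := by exact_mod_cast hk
    have hd : ∀ t ∈ Set.uIcc (0 : ℝ) 1,
        HasDerivAt (fun t => ((k : ℝ) ^ (i + 1))⁻¹ * ((fwdDiff (k : ℝ))^[i] (G (i + 1))) (x + k * t))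
          (J i k (x + k * t)) t := by
      intro t _
      have h1 := hasDerivAt_fwdDiff_iter (hG i hi) k i (x + k * t)
      have h2 : HasDerivAt (fun t : ℝ => x + k * t) k t := by
        simpa using ((hasDerivAt_id t).const_mul (k : ℝ)).const_add x
      refine ((h1.comp t h2).const_mul (((k : ℝ) ^ (i + 1))⁻¹)).congr_deriv ?_
      simp only [J, hk, if_false]
      field_simp
      ring
    rw [intervalIntegral.integral_eq_sub_of_hasDerivAt hd
      (((hJc i hi.le k).comp (by fun_prop)).intervalIntegrable _ _)]
    simp only [J, hk, if_false, Function.iterate_succ_apply', fwdDiff]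
    simp only [mul_one, mul_zero, add_zero]
    ring
  have key : ∀ i ≤ n, ∀ a ∈ Set.Icc (0 : ℝ) (n - i), ∀ x,
      |∑ k ∈ Finset.range (n + 1), ((-1 : ℝ) ^ (n - k) * n.choose k) * J i k (x + k * a)| ≤ ε := by
    intro i
    induction i with
    | zero =>
      intro _ a ha x
      refine le_trans (le_of_eq ?_) (hF a (by simpa using ha) x)
      rw [fwdDiff_iter_eq_sum_shift]
      congr 1
      refine Finset.sum_congr rfl fun k _ => ?_
      by_cases hk : k = 0
      · simp [J, hk]
      · simp [J, hk]
    | succ i ih =>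
      intro hi a ha x
      push_cast at ha
      have e : ∑ k ∈ Finset.range (n + 1),
            ((-1 : ℝ) ^ (n - k) * n.choose k) * J (i + 1) k (x + k * a)
          = ∫ t in (0 : ℝ)..1, ∑ k ∈ Finset.range (n + 1),
            ((-1 : ℝ) ^ (n - k) * n.choose k) * J i k (x + k * (a + t)) := by
        rw [intervalIntegral.integral_finsetSum]
        · refine Finset.sum_congr rfl fun k _ => ?_
          rw [intervalIntegral.integral_const_mul, ← hJ i hi]
          simp only [mul_add, add_assoc]
        · intro k _
          refine Continuous.intervalIntegrable ?_ _ _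
          exact continuous_const.mul ((hJc i (by omega) k).comp (by fun_prop))
      rw [e]
      have := intervalIntegral.norm_integral_le_of_norm_le_const (a := 0) (b := 1) (C := ε)
        (f := fun t => ∑ k ∈ Finset.range (n + 1),
            ((-1 : ℝ) ^ (n - k) * n.choose k) * J i k (x + k * (a + t))) ?_
      · simpa using this
      · intro t ht
        rw [Set.uIoc_of_le zero_le_one] at ht
        exact ih (by omega) (a + t) ⟨by linarith [ha.1, ht.1], by linarith [ha.2, ht.2]⟩ x
  have h1 := key n le_rfl 0 (by simp) x
  simp only [mul_zero, add_zero] at h1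
  rw [Finset.sum_range_succ'] at h1
  have e0 : ((-1 : ℝ) ^ (n - 0) * (n.choose 0 : ℕ)) * J n 0 x = (-1) ^ n * G 0 x := by simp [J]
  rw [e0] at h1
  set S := ∑ k ∈ Finset.range n, ((-1 : ℝ) ^ (n - (k + 1)) * n.choose (k + 1)) * J n (k + 1) x
    with hS
  have hSle : |S| ≤ ∑ k ∈ Finset.range n, (n.choose (k + 1) : ℝ) * ε := by
    refine (Finset.abs_sum_le_sum_abs _ _).trans (Finset.sum_le_sum fun k hk => ?_)
    rw [abs_mul, abs_mul, abs_pow, abs_neg, abs_one, one_pow, one_mul, Nat.abs_cast]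
    refine mul_le_mul_of_nonneg_left ?_ (by positivity)
    have hk' : k + 1 ≤ n := Finset.mem_range.1 hk
    simp only [J, Nat.succ_ne_zero, if_false]
    rw [abs_mul]
    have h2 := hGn ((k + 1 : ℕ) : ℝ) ⟨by positivity, by exact_mod_cast hk'⟩ x
    have h3 : |(((k + 1 : ℕ) : ℝ) ^ n)⁻¹| ≤ 1 := by
      rw [abs_of_nonneg (by positivity)]
      exact inv_le_one_of_one_le₀ (one_le_pow₀ (by push_cast; linarith [k.cast_nonneg (α := ℝ)]))
    calc _ ≤ 1 * ε := mul_le_mul h3 h2 (abs_nonneg _) zero_le_one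
      _ = ε := one_mul _
  have hsum : ∑ k ∈ Finset.range n, (n.choose (k + 1) : ℝ) * ε + ε = 2 ^ n * ε := by
    have h2 : ∑ k ∈ Finset.range (n + 1), (n.choose k : ℝ) = 2 ^ n := by
      exact_mod_cast Nat.sum_range_choose n
    rw [Finset.sum_range_succ'] at h2
    rw [← h2, ← Finset.sum_mul]
    simp
    ring
  have h2 : |G 0 x| = |(-1) ^ n * G 0 x| := by simp [abs_mul]
  rw [h2]
  have h3 := abs_sub (S + (-1) ^ n * G 0 x) S
  rw [add_sub_cancel_left] at h3
  linarith

/-! ### Rapidly decreasing functions on the line -/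

/-- `g` decays faster than every power of `|x|` (no derivative is involved). -/
def RapidDecay (g : ℝ → ℝ) : Prop := ∀ N : ℕ, ∃ K : ℝ, ∀ x : ℝ, (1 + |x|) ^ N * |g x| ≤ K

/-- The integrable weight `(1 + |x|)⁻²`. -/
noncomputable def decayWeight (x : ℝ) : ℝ := ((1 + |x|) ^ 2)⁻¹

theorem decayWeight_pos (x : ℝ) : 0 < decayWeight x := by unfold decayWeight; positivity

theorem decayWeight_le_one (x : ℝ) : decayWeight x ≤ 1 :=
  inv_le_one_of_one_le₀ (one_le_pow₀ (by linarith [abs_nonneg x]))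

theorem continuous_decayWeight : Continuous decayWeight := by
  unfold decayWeight
  exact Continuous.inv₀ (by fun_prop) fun x => by positivity

theorem integrable_decayWeight : Integrable decayWeight := by
  have := integrable_one_add_norm (E := ℝ) (μ := volume) (r := 2) (by simp)
  refine this.congr (Filter.Eventually.of_forall fun x => ?_)
  simp only [decayWeight, Real.norm_eq_abs]
  rw [Real.rpow_neg (by positivity)]
  norm_num

theorem decayWeight_add_le (x : ℝ) {t T : ℝ} (ht : |t| ≤ T) :
    decayWeight (x + t) ≤ (1 + T) ^ 2 * decayWeight x := by
  unfold decayWeight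
  have hT : 0 ≤ T := (abs_nonneg t).trans ht
  rw [← div_eq_mul_inv, inv_eq_one_div, div_le_div_iff₀ (by positivity) (by positivity), one_mul,
    ← mul_pow]
  have h1 : |x| ≤ |x + t| + |t| := by
    have := abs_sub (x + t) t
    rwa [add_sub_cancel_right] at this
  gcongr
  nlinarith [abs_nonneg (x + t)]

theorem RapidDecay.exists_le_decayWeight {g : ℝ → ℝ} (hg : RapidDecay g) :
    ∃ K, 0 ≤ K ∧ ∀ x, |g x| ≤ K * decayWeight x := by
  obtain ⟨K, hK⟩ := hg 2
  refine ⟨K, (by positivity : (0 : ℝ) ≤ (1 + |0|) ^ 2 * |g 0|).trans (hK 0), fun x => ?_⟩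
  rw [decayWeight, ← div_eq_mul_inv, le_div_iff₀ (by positivity), mul_comm]
  exact hK x

theorem RapidDecay.integrable {g : ℝ → ℝ} (hg : RapidDecay g) (hc : Continuous g) :
    Integrable g := by
  obtain ⟨K, -, hK⟩ := hg.exists_le_decayWeight
  exact (integrable_decayWeight.const_mul K).mono' hc.aestronglyMeasurable
    (Filter.Eventually.of_forall hK)

theorem RapidDecay.exists_abs_le {g : ℝ → ℝ} (hg : RapidDecay g) : ∃ K, ∀ x, |g x| ≤ K := by
  obtain ⟨K, hK⟩ := hg 0
  exact ⟨K, fun x => by simpa using hK x⟩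

theorem RapidDecay.eq_zero_of_const {c : ℝ} (h : RapidDecay fun _ => c) : c = 0 := by
  obtain ⟨K, hK⟩ := h 1
  by_contra hc
  have hc' : 0 < |c| := abs_pos.2 hc
  have h1 := hK (|K| / |c|)
  rw [pow_one, abs_of_nonneg (by positivity), add_mul, div_mul_cancel₀ _ hc'.ne'] at h1
  linarith [le_abs_self K]

/-- The iterated antiderivatives of `g` that start from `-∞`. -/
noncomputable def primitive (g : ℝ → ℝ) : ℕ → ℝ → ℝ
  | 0 => g
  | n + 1 => fun x => ∫ y in Set.Iic x, primitive g n y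

theorem hasDerivAt_integral_Iic {g : ℝ → ℝ} (hc : Continuous g) (hi : Integrable g) (x : ℝ) :
    HasDerivAt (fun x => ∫ y in Set.Iic x, g y) (g x) x := by
  have e : (fun x => ∫ y in Set.Iic x, g y)
      = fun x => (∫ y in (0 : ℝ)..x, g y) + ∫ y in Set.Iic 0, g y := by
    funext x
    rw [← intervalIntegral.integral_Iic_sub_Iic hi.integrableOn hi.integrableOn]
    ring
  rw [e]
  exact (hc.integral_hasStrictDerivAt 0 x).hasDerivAt.add_const _

/-- The antiderivative of a rapidly decreasing function of integral zero is rapidly decreasing. -/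
theorem RapidDecay.integral_Iic {g : ℝ → ℝ} (hg : RapidDecay g) (hc : Continuous g)
    (h0 : ∫ x, g x = 0) : RapidDecay fun x => ∫ y in Set.Iic x, g y := by
  intro N
  obtain ⟨K, hK⟩ := hg (N + 2)
  have hi := hg.integrable hc
  have key : ∀ (x : ℝ) (s : Set ℝ), MeasurableSet s → (∀ y ∈ s, |x| ≤ |y|) →
      (1 + |x|) ^ N * |∫ y in s, g y| ≤ K * ∫ y, decayWeight y := by
    intro x s hs hxs
    have h1 : |∫ y in s, g y| ≤ ∫ y in s, ((1 + |x|) ^ N)⁻¹ * (K * decayWeight y) := by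
      rw [← Real.norm_eq_abs]
      refine norm_integral_le_of_norm_le
        ((integrable_decayWeight.const_mul K).const_mul _).integrableOn
        ((ae_restrict_iff' hs).2 (Filter.Eventually.of_forall fun y hy => ?_))
      rw [inv_mul_eq_div, le_div_iff₀ (by positivity), decayWeight, ← div_eq_mul_inv,
        le_div_iff₀ (by positivity), Real.norm_eq_abs]
      calc |g y| * (1 + |x|) ^ N * (1 + |y|) ^ 2 ≤ |g y| * (1 + |y|) ^ N * (1 + |y|) ^ 2 := by
            gcongr |g y| * (1 + ?_) ^ N * _
            exact hxs y hy
        _ = (1 + |y|) ^ (N + 2) * |g y| := by ring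
        _ ≤ K := hK y
    have hK0 : 0 ≤ K := (by positivity : (0 : ℝ) ≤ (1 + |0|) ^ (N + 2) * |g 0|).trans (hK 0)
    have h2 : ∫ y in s, ((1 + |x|) ^ N)⁻¹ * (K * decayWeight y)
        ≤ ∫ y, ((1 + |x|) ^ N)⁻¹ * (K * decayWeight y) := by
      refine setIntegral_le_integral ((integrable_decayWeight.const_mul K).const_mul _)
        (Filter.Eventually.of_forall fun y => ?_)
      have := (decayWeight_pos y).le
      simp only [Pi.zero_apply]
      positivity
    have h3 := h1.trans h2
    rw [integral_const_mul, integral_const_mul] at h3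
    calc _ ≤ (1 + |x|) ^ N * (((1 + |x|) ^ N)⁻¹ * (K * ∫ y, decayWeight y)) := by
          gcongr
      _ = _ := by field_simp
  refine ⟨K * ∫ y, decayWeight y, fun x => ?_⟩
  rcases le_total x 0 with hx | hx
  · refine key x _ measurableSet_Iic fun y hy => ?_
    have hy : y ≤ x := hy
    rw [abs_of_nonpos hx, abs_of_nonpos (hy.trans hx)]
    linarith
  · have e : ∫ y in Set.Iic x, g y = -∫ y in Set.Ioi x, g y := by
      have := integral_add_compl (measurableSet_Iic (a := x)) hi
      rw [h0, Set.compl_Iic] at this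
      linarith
    dsimp only
    rw [e, abs_neg]
    refine key x _ measurableSet_Ioi fun y hy => ?_
    have hy : x < y := hy
    rw [abs_of_nonneg hx, abs_of_nonneg (hx.trans hy.le)]
    exact hy.le

/-! ### Vanishing integrals of the antiderivatives of a wavelet -/

theorem integral_comp_two_pow_mul_sub (g : ℝ → ℝ) (J : ℕ) (k : ℝ) :
    ∫ x, g (2 ^ J * x - k) = (2 ^ J)⁻¹ * ∫ x, g x := by
  have := Measure.integral_comp_mul_left (fun z => g (z - k)) ((2 : ℝ) ^ J)
  rw [this, integral_sub_right_eq_self, smul_eq_mul, abs_of_pos (by positivity)]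

theorem tendsto_floor_two_pow_mul_div (x : ℝ) :
    Filter.Tendsto (fun J : ℕ => (⌊2 ^ J * x⌋ : ℝ) / 2 ^ J) Filter.atTop (nhds x) := by
  have h1 : Filter.Tendsto (fun J : ℕ => x - ((1 : ℝ) / 2) ^ J) Filter.atTop (nhds (x - 0)) :=
    (tendsto_pow_atTop_nhds_zero_of_lt_one (by norm_num) (by norm_num)).const_sub _
  rw [sub_zero] at h1
  refine tendsto_of_tendsto_of_tendsto_of_le_of_le h1 tendsto_const_nhds (fun J => ?_)
    (fun J => ?_)
  · have := (Int.sub_one_lt_floor (2 ^ J * x)).le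
    simp only
    rw [le_div_iff₀ (by positivity), sub_mul, ← mul_pow]
    norm_num
    linarith
  · simp only
    rw [div_le_iff₀ (by positivity), mul_comm]
    exact Int.floor_le _

/-- If `g` is orthogonal at all fine scales to a function `u` that does not vanish identically, then
`g` has integral zero: near a point where `u ≠ 0`, rescaling freezes `u`. -/
theorem integral_eq_zero_of_orthogonal {u g : ℝ → ℝ} (hu : Continuous u) {K : ℝ}
    (hK : ∀ x, |u x| ≤ K) {x₀ : ℝ} (hx : u x₀ ≠ 0) (hg : Integrable g)
    (horth : ∀ J : ℕ, 1 ≤ J → ∀ k : ℤ, ∫ x, u x * g (2 ^ J * x - k) = 0) :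
    ∫ x, g x = 0 := by
  have h1 : ∀ J : ℕ, 1 ≤ J → ∀ k : ℤ, ∫ y, u (y / 2 ^ J + k / 2 ^ J) * g y = 0 := by
    intro J hJ k
    have h2 := integral_comp_two_pow_mul_sub (fun y => u (y / 2 ^ J + k / 2 ^ J) * g y) J k
    have e : (fun x => u ((2 ^ J * x - k) / 2 ^ J + k / 2 ^ J) * g (2 ^ J * x - k))
        = fun x => u x * g (2 ^ J * x - k) := by
      funext x
      congr 2
      field_simp
      ring
    rw [e, horth J hJ k] at h2
    have h3 : ((2 : ℝ) ^ J)⁻¹ ≠ 0 := by positivity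
    exact (mul_eq_zero.1 h2.symm).resolve_left h3
  have h2 : Filter.Tendsto
      (fun J : ℕ => ∫ y, u (y / 2 ^ J + (⌊2 ^ J * x₀⌋ : ℝ) / 2 ^ J) * g y) Filter.atTop
      (nhds (∫ y, u x₀ * g y)) := by
    refine tendsto_integral_of_dominated_convergence (fun y => K * ‖g y‖) (fun J => ?_)
      (hg.norm.const_mul K) (fun J => Filter.Eventually.of_forall fun y => ?_)
      (Filter.Eventually.of_forall fun y => ?_)
    · exact (hu.comp (by fun_prop)).aestronglyMeasurable.mul hg.aestronglyMeasurable
    · rw [norm_mul]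
      exact mul_le_mul_of_nonneg_right (hK _) (norm_nonneg _)
    · refine Filter.Tendsto.mul_const _ ((hu.tendsto x₀).comp ?_)
      have h3 : Filter.Tendsto (fun J : ℕ => y / (2 : ℝ) ^ J) Filter.atTop (nhds 0) :=
        tendsto_const_nhds.div_atTop (tendsto_pow_atTop_atTop_of_one_lt (by norm_num))
      simpa using h3.add (tendsto_floor_two_pow_mul_div x₀)
  have h3 : ∫ y, u x₀ * g y = 0 := by
    refine tendsto_nhds_unique h2 (tendsto_const_nhds.congr' ?_)
    filter_upwards [Filter.eventually_ge_atTop 1] with J hJ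
    exact (h1 J hJ _).symm
  rw [integral_const_mul] at h3
  exact (mul_eq_zero.1 h3).resolve_left hx

theorem exists_iteratedDeriv_ne_zero {M : ℕ} {ψ : ℝ → ℝ} (hψ : ContDiff ℝ M ψ)
    (hd : FastDecay M ψ) (hne : ∃ x, ψ x ≠ 0) {n : ℕ} (hn : n ≤ M) :
    ∃ x, iteratedDeriv n ψ x ≠ 0 := by
  induction n with
  | zero => simpa using hne
  | succ n ih =>
    by_contra! hcon
    obtain ⟨x, hx⟩ := ih (by omega)
    have hdiff : Differentiable ℝ (iteratedDeriv n ψ) :=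
      hψ.differentiable_iteratedDeriv n (by exact_mod_cast hn)
    have hconst := is_const_of_deriv_eq_zero hdiff fun y => by
      rw [← iteratedDeriv_succ]; exact hcon y
    have e : iteratedDeriv n ψ = fun _ => iteratedDeriv n ψ x := by
      funext y; exact hconst y x
    have hr : RapidDecay (iteratedDeriv n ψ) := hd n (by omega)
    rw [e] at hr
    exact hx hr.eq_zero_of_const

/-- A `C^M` function `ψ` with rapidly decreasing derivatives that is orthogonal to its dilates and
translates at finer scales is the `M`-th derivative of a rapidly decreasing function: it has `M`
vanishing moments. Integrating by parts moves derivatives between the two factors of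
`∫ ψ (x) ψ (2^J x - k) dx = 0`, and then the finer factor must have integral zero. -/
theorem primitive_properties {M : ℕ} {ψ : ℝ → ℝ} (hψ : ContDiff ℝ M ψ)
    (hd : FastDecay M ψ) (hne : ∃ x, ψ x ≠ 0)
    (horth : ∀ J : ℕ, 1 ≤ J → ∀ k : ℤ, ∫ x, ψ x * ψ (2 ^ J * x - k) = 0) {n : ℕ} (hn : n ≤ M) :
    Continuous (primitive ψ n) ∧ RapidDecay (primitive ψ n) ∧
      (∀ J : ℕ, 1 ≤ J → ∀ k : ℤ,
        ∫ x, iteratedDeriv n ψ x * primitive ψ n (2 ^ J * x - k) = 0) ∧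
      ∀ i < n, ∀ x, HasDerivAt (primitive ψ (i + 1)) (primitive ψ i x) x := by
  induction n with
  | zero =>
    refine ⟨hψ.continuous, ?_, ?_, by simp⟩
    · intro N; simpa [primitive] using hd 0 (by omega) N
    · simpa [primitive] using horth
  | succ n ih =>
    obtain ⟨hc, hr, ho, hD⟩ := ih (by omega)
    have hi := hr.integrable hc
    obtain ⟨x₀, hx₀⟩ := exists_iteratedDeriv_ne_zero hψ hd hne (n := n) (by omega)
    have hcn : ∀ m ≤ M, Continuous (iteratedDeriv m ψ) := fun m hm =>
      hψ.continuous_iteratedDeriv m (by exact_mod_cast hm)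
    have hrn : ∀ m ≤ M, RapidDecay (iteratedDeriv m ψ) := fun m hm => hd m hm
    obtain ⟨K, hK⟩ := (hrn n (by omega)).exists_abs_le
    have h0 : ∫ x, primitive ψ n x = 0 :=
      integral_eq_zero_of_orthogonal (hcn n (by omega)) hK hx₀ hi ho
    have hderiv : ∀ x, HasDerivAt (primitive ψ (n + 1)) (primitive ψ n x) x :=
      hasDerivAt_integral_Iic hc hi
    have hc' : Continuous (primitive ψ (n + 1)) :=
      continuous_iff_continuousAt.2 fun x => (hderiv x).continuousAt
    have hr' : RapidDecay (primitive ψ (n + 1)) := hr.integral_Iic hc h0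
    refine ⟨hc', hr', fun J hJ k => ?_, fun i hi' => ?_⟩
    · have hlin : ∀ x : ℝ, HasDerivAt (fun x : ℝ => 2 ^ J * x - k) (2 ^ J) x := fun x => by
        simpa using ((hasDerivAt_id x).const_mul ((2 : ℝ) ^ J)).sub_const (k : ℝ)
      have hmul : ∀ m ≤ M, ∀ g : ℝ → ℝ, Continuous g → RapidDecay g →
          Integrable fun x => iteratedDeriv m ψ x * g (2 ^ J * x - k) := by
        intro m hm g hg hgr
        obtain ⟨K, hK⟩ := hgr.exists_abs_le
        exact ((hrn m hm).integrable (hcn m hm)).mul_bdd (c := K)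
          (hg.comp (by fun_prop)).aestronglyMeasurable
          (Filter.Eventually.of_forall fun x => hK _)
      have hparts := integral_mul_deriv_eq_deriv_mul_of_integrable
        (u := iteratedDeriv n ψ) (u' := iteratedDeriv (n + 1) ψ)
        (v := fun x => primitive ψ (n + 1) (2 ^ J * x - k))
        (v' := fun x => primitive ψ n (2 ^ J * x - k) * 2 ^ J)
        (fun x _ => by
          rw [iteratedDeriv_succ]
          exact (hψ.differentiable_iteratedDeriv n (by exact_mod_cast hn) x).hasDerivAt)
        (fun x _ => HasDerivAt.comp (h₂ := primitive ψ (n + 1)) x (hderiv (2 ^ J * x - k)) (hlin x))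
        (by
          have := (hmul n (by omega) _ hc hr).mul_const ((2 : ℝ) ^ J)
          simpa only [Pi.mul_def, mul_assoc] using this)
        (hmul (n + 1) hn _ hc' hr') (hmul n (by omega) _ hc' hr')
      have e : ∫ x, iteratedDeriv n ψ x * (primitive ψ n (2 ^ J * x - k) * 2 ^ J) = 0 := by
        simp_rw [← mul_assoc]
        rw [integral_mul_const, ho J hJ k, zero_mul]
      rw [e] at hparts
      linarith
    · rcases Nat.lt_succ_iff_lt_or_eq.1 hi' with h | rfl
      · exact hD i h
      · exact hderiv

/-! ### Tensor products and lattice sums -/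

/-- The tensor product `x ↦ ∏ m, g m (x m)` of functions of one variable. -/
noncomputable def tensorFn {d : ℕ} (g : Fin d → ℝ → ℝ) (x : EuclideanSpace ℝ (Fin d)) : ℝ :=
  ∏ m, g m (x m)

/-- The tensor power of the weight `(1 + |x|)⁻²`. -/
noncomputable def tensorWeight {d : ℕ} (x : EuclideanSpace ℝ (Fin d)) : ℝ :=
  tensorFn (fun _ => decayWeight) x

/-- The point of `ℝ^d` with integer coordinates `k`. -/
noncomputable def latticePoint {d : ℕ} (k : Fin d → ℤ) : EuclideanSpace ℝ (Fin d) :=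
  WithLp.toLp 2 fun m => (k m : ℝ)

/-- The one-variable factors of the tensor product function of type `i`. -/
def typeFactors {d : ℕ} (φ ψ : ℝ → ℝ) (i : Fin d → Bool) (m : Fin d) : ℝ → ℝ :=
  if i m then ψ else φ

theorem tensorWavelet_eq {d : ℕ} (φ ψ : ℝ → ℝ) (i : Fin d → Bool) (j : ℕ) (k : Fin d → ℤ) :
    tensorWavelet φ ψ i j k
      = fun x => tensorFn (typeFactors φ ψ i) ((2 : ℝ) ^ j • x - latticePoint k) := by
  funext x
  simp [tensorWavelet, tensorFn, typeFactors, latticePoint]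

theorem continuous_tensorFn {d : ℕ} {g : Fin d → ℝ → ℝ} (hg : ∀ m, Continuous (g m)) :
    Continuous (tensorFn g) :=
  continuous_finsetProd _ fun m _ => (hg m).comp (by fun_prop)

theorem tensorWeight_le_one {d : ℕ} (x : EuclideanSpace ℝ (Fin d)) : tensorWeight x ≤ 1 := by
  unfold tensorWeight tensorFn
  exact Finset.prod_le_one (fun _ _ => (decayWeight_pos _).le) fun _ _ => decayWeight_le_one _

theorem continuous_tensorWeight {d : ℕ} :
    Continuous (tensorWeight : EuclideanSpace ℝ (Fin d) → ℝ) :=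
  continuous_tensorFn fun _ => continuous_decayWeight

theorem integrable_tensorFn {d : ℕ} {g : Fin d → ℝ → ℝ} (hg : ∀ m, Integrable (g m)) :
    Integrable (tensorFn g) := by
  have h1 : Integrable (fun x : Fin d → ℝ => ∏ m, g m (x m)) := by
    rw [volume_pi]
    exact Integrable.fintype_prod hg
  exact ((PiLp.volume_preserving_ofLp (Fin d)).integrable_comp_emb
    (MeasurableEquiv.toLp 2 (Fin d → ℝ)).symm.measurableEmbedding).2 h1

theorem integral_tensorFn {d : ℕ} (g : Fin d → ℝ → ℝ) :
    ∫ x, tensorFn g x = ∏ m, ∫ x, g m x := by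
  rw [← integral_fintype_prod_volume_eq_prod]
  exact (PiLp.volume_preserving_ofLp (Fin d)).integral_comp
    (MeasurableEquiv.toLp 2 (Fin d → ℝ)).symm.measurableEmbedding (fun x => ∏ m, g m (x m))

theorem integrable_tensorWeight {d : ℕ} :
    Integrable (tensorWeight : EuclideanSpace ℝ (Fin d) → ℝ) :=
  integrable_tensorFn fun _ => integrable_decayWeight

theorem abs_apply_le_norm {d : ℕ} (v : EuclideanSpace ℝ (Fin d)) (m : Fin d) : |v m| ≤ ‖v‖ := by
  simpa using PiLp.norm_apply_le v m

theorem tensorWeight_add_le {d : ℕ} (x : EuclideanSpace ℝ (Fin d)) {v : EuclideanSpace ℝ (Fin d)}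
    {T : ℝ} (hv : ‖v‖ ≤ T) : tensorWeight (x + v) ≤ ((1 + T) ^ 2) ^ d * tensorWeight x := by
  have e : ((1 + T) ^ 2) ^ d * tensorWeight x = ∏ m : Fin d, ((1 + T) ^ 2 * decayWeight (x m)) := by
    rw [Finset.prod_mul_distrib]
    simp [tensorWeight, tensorFn]
  rw [e]
  unfold tensorWeight tensorFn
  exact Finset.prod_le_prod (fun _ _ => (decayWeight_pos _).le) fun m _ =>
    decayWeight_add_le (x m) ((abs_apply_le_norm v m).trans hv)

theorem exists_abs_tensorFn_le {d : ℕ} {g : Fin d → ℝ → ℝ} (hg : ∀ m, RapidDecay (g m)) :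
    ∃ K, 0 ≤ K ∧ ∀ x, |tensorFn g x| ≤ K * tensorWeight x := by
  choose K hK0 hK using fun m => (hg m).exists_le_decayWeight
  refine ⟨∏ m, K m, Finset.prod_nonneg fun m _ => hK0 m, fun x => ?_⟩
  rw [tensorWeight, tensorFn, tensorFn, Finset.abs_prod, ← Finset.prod_mul_distrib]
  exact Finset.prod_le_prod (fun _ _ => abs_nonneg _) fun m _ => hK m _

theorem summable_decayWeight_int : Summable fun k : ℤ => decayWeight k := by
  refine Summable.of_norm_bounded_eventually
    (Real.summable_one_div_int_pow.2 (by norm_num : 1 < 2)) ?_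
  filter_upwards [(Set.finite_singleton (0 : ℤ)).compl_mem_cofinite] with k hk
  have hk0 : (k : ℝ) ≠ 0 := by exact_mod_cast hk
  rw [Real.norm_of_nonneg (decayWeight_pos _).le, decayWeight, inv_eq_one_div, ← sq_abs (k : ℝ)]
  have : 0 < |(k : ℝ)| := abs_pos.2 hk0
  gcongr
  linarith

/-- A bound, uniform in `x`, for the lattice sums `∑ₖ tensorWeight (x - k)`. -/
noncomputable def latticeBound (d : ℕ) : ENNReal :=
  (∑' k : ℤ, ENNReal.ofReal (4 * decayWeight k)) ^ d

theorem latticeBound_ne_top (d : ℕ) : latticeBound d ≠ ⊤ := by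
  refine ENNReal.pow_ne_top ?_
  rw [← ENNReal.ofReal_tsum_of_nonneg (fun k => by linarith [decayWeight_pos k])
    (summable_decayWeight_int.mul_left 4)]
  exact ENNReal.ofReal_ne_top

theorem tsum_decayWeight_sub_le (y : ℝ) :
    ∑' k : ℤ, ENNReal.ofReal (decayWeight (y - k))
      ≤ ∑' k : ℤ, ENNReal.ofReal (4 * decayWeight k) := by
  rw [← (Equiv.subLeft ⌊y⌋).tsum_eq (fun k : ℤ => ENNReal.ofReal (4 * decayWeight k))]
  refine ENNReal.tsum_le_tsum fun k => ENNReal.ofReal_le_ofReal ?_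
  have h := decayWeight_add_le ((⌊y⌋ - k : ℤ) : ℝ) (t := Int.fract y) (T := 1)
    (by rw [abs_of_nonneg (Int.fract_nonneg y)]; exact (Int.fract_lt_one y).le)
  have e : ((⌊y⌋ - k : ℤ) : ℝ) + Int.fract y = y - k := by
    push_cast
    linarith [Int.floor_add_fract y]
  rw [e] at h
  norm_num at h ⊢
  exact h

/-- A sum over `ℤ^d` of products is at most the product of the sums. -/
theorem tsum_pi_prod_le {d : ℕ} {ι : Type*} (F : Fin d → ι → ENNReal) :
    ∑' k : Fin d → ι, ∏ m, F m (k m) ≤ ∏ m, ∑' a, F m a := by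
  classical
  rw [ENNReal.tsum_eq_iSup_sum]
  refine iSup_le fun s => ?_
  calc ∑ k ∈ s, ∏ m, F m (k m)
      ≤ ∑ k ∈ Fintype.piFinset fun m => s.image fun k => k m, ∏ m, F m (k m) := by
        refine Finset.sum_le_sum_of_subset fun k hk => Fintype.mem_piFinset.2 fun m => ?_
        exact Finset.mem_image_of_mem _ hk
    _ = ∏ m, ∑ a ∈ s.image fun k => k m, F m a := (Finset.prod_univ_sum _ _).symm
    _ ≤ _ := Finset.prod_le_prod' fun m _ => ENNReal.sum_le_tsum _

theorem tsum_tensorWeight_sub_le {d : ℕ} (x : EuclideanSpace ℝ (Fin d)) :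
    ∑' k, ENNReal.ofReal (tensorWeight (x - latticePoint k)) ≤ latticeBound d := by
  have e : ∀ k : Fin d → ℤ, ENNReal.ofReal (tensorWeight (x - latticePoint k))
      = ∏ m, ENNReal.ofReal (decayWeight (x m - k m)) := fun k => by
    rw [← ENNReal.ofReal_prod_of_nonneg fun _ _ => (decayWeight_pos _).le]
    simp [tensorWeight, tensorFn, latticePoint]
  simp_rw [e]
  refine (tsum_pi_prod_le fun m (a : ℤ) => ENNReal.ofReal (decayWeight (x m - a))).trans ?_
  refine (Finset.prod_le_prod' fun m _ => tsum_decayWeight_sub_le (x m)).trans ?_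
  simp [latticeBound]

/-- The lattice translates of a function with decay, paired with an integrable function, give an
`ℓ¹` sequence with norm controlled by the `L¹` norm. -/
theorem tsum_enorm_integral_le {d : ℕ} {θ G : EuclideanSpace ℝ (Fin d) → ℝ}
    (hθ : AEStronglyMeasurable θ) {K : ℝ} (hK0 : 0 ≤ K)
    (hK : ∀ x, |G x| ≤ K * tensorWeight x) (c : ℝ) :
    ∑' k, ‖∫ x, θ x * G (c • x - latticePoint k)‖ₑ
      ≤ ENNReal.ofReal K * latticeBound d * ∫⁻ x, ‖θ x‖ₑ := by
  have hm : ∀ k : Fin d → ℤ, AEMeasurable fun x => ‖θ x‖ₑ *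
      ENNReal.ofReal (K * tensorWeight (c • x - latticePoint k)) := fun k => by
    refine hθ.enorm.mul ?_
    refine (Measurable.ennreal_ofReal ?_).aemeasurable
    exact (continuous_const.mul (continuous_tensorWeight.comp (by fun_prop))).measurable
  calc ∑' k, ‖∫ x, θ x * G (c • x - latticePoint k)‖ₑ
      ≤ ∑' k, ∫⁻ x, ‖θ x‖ₑ * ENNReal.ofReal (K * tensorWeight (c • x - latticePoint k)) := by
        refine ENNReal.tsum_le_tsum fun k => (enorm_integral_le_lintegral_enorm _).trans ?_
        refine lintegral_mono fun x => ?_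
        rw [enorm_mul]
        gcongr
        rw [Real.enorm_eq_ofReal_abs]
        exact ENNReal.ofReal_le_ofReal (hK _)
    _ = ∫⁻ x, ∑' k, ‖θ x‖ₑ * ENNReal.ofReal (K * tensorWeight (c • x - latticePoint k)) :=
        (lintegral_tsum hm).symm
    _ ≤ ∫⁻ x, ENNReal.ofReal K * latticeBound d * ‖θ x‖ₑ := by
        refine lintegral_mono fun x => ?_
        simp_rw [ENNReal.tsum_mul_left, ENNReal.ofReal_mul hK0, ENNReal.tsum_mul_left]
        rw [mul_comm]
        gcongr
        exact tsum_tensorWeight_sub_le _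
    _ = _ := lintegral_const_mul'' _ hθ.enorm

/-! ### Finite differences of tensor products -/

theorem iteratedDeriv_comp_add_mul {g : ℝ → ℝ} {M n : ℕ} (hg : ContDiff ℝ M g) (hn : n ≤ M)
    (x c t : ℝ) :
    iteratedDeriv n (fun t => g (x + t * c)) t = c ^ n * iteratedDeriv n g (x + t * c) := by
  have hg' : ContDiff ℝ n (fun z => g (x + z)) :=
    (hg.of_le (by exact_mod_cast hn)).comp (contDiff_const.add contDiff_id)
  have h1 := iteratedDeriv_comp_const_mul hg' c
  have h2 := congrFun h1 t
  rw [iteratedDeriv_comp_const_add] at h2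
  simp only [mul_comm c] at h2
  simpa using h2

/-- The `M`-th differences of a tensor product are of order `‖h‖ ^ M` and retain its decay. -/
theorem exists_abs_fwdDiff_iter_tensorFn_le {d M : ℕ} {g : Fin d → ℝ → ℝ}
    (hg : ∀ m, ContDiff ℝ M (g m)) (hd : ∀ m, FastDecay M (g m)) :
    ∃ C, 0 ≤ C ∧ ∀ h : EuclideanSpace ℝ (Fin d), ‖h‖ ≤ 1 → ∀ x,
      |((fwdDiff h)^[M] (tensorFn g)) x| ≤ C * ‖h‖ ^ M * tensorWeight x := by
  classical
  have hb : ∀ m : Fin d, ∀ s : ℕ, ∃ K, 0 ≤ K ∧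
      (s ≤ M → ∀ x, |iteratedDeriv s (g m) x| ≤ K * decayWeight x) := by
    intro m s
    by_cases hs : s ≤ M
    · obtain ⟨K, h0, hK⟩ := RapidDecay.exists_le_decayWeight (hd m s hs)
      exact ⟨K, h0, fun _ => hK⟩
    · exact ⟨0, le_rfl, fun h => absurd h hs⟩
  choose K hK0 hK using hb
  set D : ℝ := ∑ p ∈ (Finset.univ : Finset (Fin d)).sym M, ((p : Multiset (Fin d)).countPerms : ℝ) *
    ∏ m, K m ((p : Multiset (Fin d)).count m) with hD
  have hD0 : 0 ≤ D := Finset.sum_nonneg fun p _ =>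
    mul_nonneg (by positivity) (Finset.prod_nonneg fun m _ => hK0 _ _)
  have hCd : (0 : ℝ) ≤ ((1 + (M : ℝ)) ^ 2) ^ d := by positivity
  refine ⟨D * ((1 + (M : ℝ)) ^ 2) ^ d, by positivity, fun h hh x => ?_⟩
  set v : EuclideanSpace ℝ (Fin d) := ‖h‖⁻¹ • h with hv
  have hvh : ‖h‖ • v = h := by
    rcases eq_or_ne h 0 with rfl | h0
    · simp
    · rw [hv, smul_smul, mul_inv_cancel₀ (norm_ne_zero_iff.2 h0), one_smul]
  have hv1 : ‖v‖ ≤ 1 := by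
    rw [hv, norm_smul, norm_inv, norm_norm]
    exact inv_mul_le_one
  -- restrict the tensor product to the line `t ↦ x + t • v`
  set U : ℝ → ℝ := fun t => ∏ m, g m (x m + t * v m) with hU
  have hUc : ContDiff ℝ M U := by
    refine contDiff_prod fun m _ => (hg m).comp ?_
    exact contDiff_const.add (contDiff_id.mul contDiff_const)
  have e1 : ((fwdDiff h)^[M] (tensorFn g)) x = ((fwdDiff ‖h‖)^[M] U) 0 := by
    have h1 := fwdDiff_iter_comp (g := fun t : ℝ => x + t • v) (h := ‖h‖) (h' := h)
      (fun t => by rw [add_smul, hvh, add_assoc]) (tensorFn g) M 0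
    rw [zero_smul, add_zero] at h1
    rw [← h1]
    rfl
  rw [e1]
  have hbound : ∀ t ∈ Set.Icc (0 : ℝ) (0 + M * ‖h‖),
      |iteratedDeriv M U t| ≤ D * ((1 + (M : ℝ)) ^ 2) ^ d * tensorWeight x := by
    intro t ht
    rw [zero_add] at ht
    have htM : |t| ≤ M := by
      rw [abs_of_nonneg ht.1]
      exact ht.2.trans (by nlinarith [norm_nonneg h, M.cast_nonneg (α := ℝ)])
    have h1 := norm_iteratedFDeriv_prod_le (𝕜 := ℝ) (u := Finset.univ)
      (f := fun m (t : ℝ) => g m (x m + t * v m)) (N := M) (n := M) (x := t)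
      (fun m _ => (hg m).comp (contDiff_const.add (contDiff_id.mul contDiff_const))) le_rfl
    simp_rw [norm_iteratedFDeriv_eq_norm_iteratedDeriv] at h1
    refine h1.trans ?_
    have h2 : ∀ p ∈ (Finset.univ : Finset (Fin d)).sym M,
        ∏ m, ‖iteratedDeriv ((p : Multiset (Fin d)).count m) (fun t => g m (x m + t * v m)) t‖
          ≤ (∏ m, K m ((p : Multiset (Fin d)).count m)) * tensorWeight (x + t • v) := by
      intro p _
      rw [tensorWeight, tensorFn, ← Finset.prod_mul_distrib]
      refine Finset.prod_le_prod (fun _ _ => norm_nonneg _) fun m _ => ?_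
      have hc : (p : Multiset (Fin d)).count m ≤ M :=
        (Multiset.count_le_card _ _).trans (le_of_eq p.2)
      rw [iteratedDeriv_comp_add_mul (hg m) hc, Real.norm_eq_abs, abs_mul, abs_pow]
      have h3 : |v m| ^ (p : Multiset (Fin d)).count m ≤ 1 :=
        pow_le_one₀ (abs_nonneg _) ((abs_apply_le_norm v m).trans hv1)
      calc _ ≤ 1 * |iteratedDeriv ((p : Multiset (Fin d)).count m) (g m) (x m + t * v m)| := by
            gcongr
        _ ≤ _ := by
            rw [one_mul]
            exact hK m _ hc _
    have h4 : tensorWeight (x + t • v) ≤ ((1 + (M : ℝ)) ^ 2) ^ d * tensorWeight x := by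
      refine tensorWeight_add_le x ?_
      rw [norm_smul, Real.norm_eq_abs]
      calc _ ≤ (M : ℝ) * 1 := mul_le_mul htM hv1 (norm_nonneg _) (by positivity)
        _ = _ := mul_one _
    calc _ ≤ ∑ p ∈ (Finset.univ : Finset (Fin d)).sym M,
          ((p : Multiset (Fin d)).countPerms : ℝ) *
            ((∏ m, K m ((p : Multiset (Fin d)).count m)) * tensorWeight (x + t • v)) :=
          Finset.sum_le_sum fun p hp => mul_le_mul_of_nonneg_left (h2 p hp) (by positivity)
      _ = D * tensorWeight (x + t • v) := by
          rw [hD, Finset.sum_mul]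
          exact Finset.sum_congr rfl fun p _ => by ring
      _ ≤ D * (((1 + (M : ℝ)) ^ 2) ^ d * tensorWeight x) := by gcongr
      _ = _ := by ring
  have h1 := abs_fwdDiff_iter_le_of_hasDerivAt (n := M) (u := fun i => iteratedDeriv i U)
    (fun i hi t => by
      simp only [iteratedDeriv_succ]
      exact (hUc.differentiable_iteratedDeriv i (by exact_mod_cast hi) t).hasDerivAt)
    (norm_nonneg h) hbound
  rw [iteratedDeriv_zero] at h1
  calc _ ≤ _ := h1
    _ = _ := by ring

/-! ### Wavelet coefficients are controlled by the modulus of smoothness -/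

theorem fwdDiff_iter_integral {X : Type*} [MeasurableSpace X] {μ : Measure X} {p : ℝ → X → ℝ}
    (hp : ∀ t, Integrable (p t) μ) (s : ℝ) (n : ℕ) (t : ℝ) :
    ((fwdDiff s)^[n] fun t => ∫ x, p t x ∂μ) t = ∫ x, ((fwdDiff s)^[n] fun t => p t x) t ∂μ := by
  induction n generalizing p with
  | zero => rfl
  | succ n ih =>
    simp only [Function.iterate_succ_apply]
    have e : (fwdDiff s fun t => ∫ x, p t x ∂μ) = fun t => ∫ x, (p (t + s) x - p t x) ∂μ := by
      funext t
      rw [integral_sub (hp _) (hp _)]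
      rfl
    rw [e]
    exact ih (p := fun t x => p (t + s) x - p t x) fun t => (hp (t + s)).sub (hp t)

theorem aestronglyMeasurable_comp_smul_add {d : ℕ} {f : EuclideanSpace ℝ (Fin d) → ℝ}
    (hf : AEStronglyMeasurable f) {c : ℝ} (hc : c ≠ 0) (v : EuclideanSpace ℝ (Fin d)) :
    AEStronglyMeasurable fun x => f (c • x + v) := by
  have h1 : Measure.QuasiMeasurePreserving
      (fun x : EuclideanSpace ℝ (Fin d) => c • x) volume volume := by
    refine ⟨measurable_const_smul c, ?_⟩
    rw [Measure.map_addHaar_smul _ hc]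
    exact Measure.smul_absolutelyContinuous
  have h2 : Measure.QuasiMeasurePreserving
      (fun x : EuclideanSpace ℝ (Fin d) => x + v) volume volume :=
    (measurePreserving_add_right volume v).quasiMeasurePreserving
  exact hf.comp_quasiMeasurePreserving (h2.comp h1)

theorem tensorFn_update {d : ℕ} (g : Fin d → ℝ → ℝ) (m : Fin d) (A : ℝ → ℝ)
    (x : EuclideanSpace ℝ (Fin d)) :
    tensorFn (Function.update g m A) x = A (x m) * ∏ m' ∈ Finset.univ.erase m, g m' (x m') := by
  rw [tensorFn, ← Finset.mul_prod_erase _ _ (Finset.mem_univ m), Function.update_self]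
  congr 1
  refine Finset.prod_congr rfl fun m' hm' => ?_
  rw [Function.update_of_ne (Finset.ne_of_mem_erase hm')]

/-- A tensor product is differentiated along a coordinate axis by differentiating one factor. -/
theorem hasDerivAt_tensorFn_update {d : ℕ} (g : Fin d → ℝ → ℝ) (m : Fin d) {A a : ℝ → ℝ}
    (hA : ∀ t, HasDerivAt A (a t) t) (y : EuclideanSpace ℝ (Fin d)) (t : ℝ) :
    HasDerivAt (fun t : ℝ => tensorFn (Function.update g m A) (y + t • EuclideanSpace.single m 1))
      (tensorFn (Function.update g m a) (y + t • EuclideanSpace.single m 1)) t := by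
  have e : ∀ A : ℝ → ℝ, ∀ t : ℝ,
      tensorFn (Function.update g m A) (y + t • EuclideanSpace.single m 1)
        = A (y m + t) * ∏ m' ∈ Finset.univ.erase m, g m' (y m') := by
    intro A t
    rw [tensorFn_update]
    congr 1
    · simp
    · refine Finset.prod_congr rfl fun m' hm' => ?_
      simp [Finset.ne_of_mem_erase hm']
  simp_rw [e]
  exact ((hA (y m + t)).comp_const_add (y m) t).mul_const _

/-- If one factor of a tensor product is the `n`-th derivative of a rapidly decreasing function,
pairing with the tensor product is controlled by the differences of order `n`. -/
theorem exists_abs_integral_mul_tensorFn_le {d n : ℕ} {g : Fin d → ℝ → ℝ}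
    (hgc : ∀ m, Continuous (g m)) (hgr : ∀ m, RapidDecay (g m)) (m : Fin d) {Θ : ℕ → ℝ → ℝ}
    (hΘ0 : Θ 0 = g m) (hΘc : ∀ i ≤ n, Continuous (Θ i)) (hΘr : ∀ i ≤ n, RapidDecay (Θ i))
    (hΘd : ∀ i < n, ∀ x, HasDerivAt (Θ (i + 1)) (Θ i x) x) :
    ∃ C, 0 ≤ C ∧ ∀ (f : EuclideanSpace ℝ (Fin d) → ℝ) (B ε : ℝ), AEStronglyMeasurable f →
      (∀ x, |f x| ≤ B) → (∀ h, ‖h‖ ≤ n → ∀ x, |((fwdDiff h)^[n] f) x| ≤ ε) →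
      |∫ x, f x * tensorFn g x| ≤ C * ε := by
  set e : EuclideanSpace ℝ (Fin d) := EuclideanSpace.single m 1 with he
  have he1 : ‖e‖ = 1 := by simp [he]
  set Ψ : ℕ → EuclideanSpace ℝ (Fin d) → ℝ := fun i => tensorFn (Function.update g m (Θ i)) with hΨ
  have hΨc : ∀ i ≤ n, Continuous (Ψ i) := fun i hi => continuous_tensorFn fun m' => by
    rcases eq_or_ne m' m with rfl | h
    · simpa using hΘc i hi
    · simpa [Function.update_of_ne h] using hgc m'
  have hΨr : ∀ i ≤ n, ∃ K, 0 ≤ K ∧ ∀ x, |Ψ i x| ≤ K * tensorWeight x := fun i hi =>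
    exists_abs_tensorFn_le fun m' => by
      rcases eq_or_ne m' m with rfl | h
      · simpa using hΘr i hi
      · simpa [Function.update_of_ne h] using hgr m'
  have hΨi : ∀ i ≤ n, Integrable (Ψ i) := fun i hi => by
    obtain ⟨K, -, hK⟩ := hΨr i hi
    exact (integrable_tensorWeight.const_mul K).mono' (hΨc i hi).aestronglyMeasurable
      (Filter.Eventually.of_forall hK)
  have hΨ0 : Ψ 0 = tensorFn g := by simp [hΨ, hΘ0]
  refine ⟨2 ^ n * ((∫ x, |Ψ 0 x|) + ∫ x, |Ψ n x|), by positivity, ?_⟩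
  intro f B ε hf hB hε
  have hB0 : 0 ≤ B := (abs_nonneg _).trans (hB 0)
  have hε0 : 0 ≤ ε := (abs_nonneg _).trans (hε 0 (by simp) 0)
  have hfΨ : ∀ i ≤ n, ∀ t : ℝ, Integrable fun y => f y * Ψ i (y + t • e) := fun i hi t =>
    ((hΨi i hi).comp_add_right (t • e)).bdd_mul hf (Filter.Eventually.of_forall hB)
  -- an integrable majorant that serves for all shifts `t` near `t₀`
  have hdom : ∀ i ≤ n, ∀ t₀ : ℝ, ∃ b : EuclideanSpace ℝ (Fin d) → ℝ, Integrable b ∧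
      ∀ y, ∀ t ∈ Metric.ball t₀ 1, ‖f y * Ψ i (y + t • e)‖ ≤ b y := by
    intro i hi t₀
    obtain ⟨K, hK0, hK⟩ := hΨr i hi
    refine ⟨fun y => B * (K * (((1 + 1) ^ 2) ^ d * tensorWeight (y + t₀ • e))), ?_, ?_⟩
    · exact (((integrable_tensorWeight.comp_add_right _).const_mul _).const_mul _).const_mul _
    · intro y t ht
      rw [norm_mul]
      refine mul_le_mul (hB y) ((hK _).trans ?_) (norm_nonneg _) hB0
      refine mul_le_mul_of_nonneg_left ?_ hK0
      have : y + t • e = (y + t₀ • e) + (t - t₀) • e := by module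
      rw [this]
      refine tensorWeight_add_le _ ?_
      rw [norm_smul, he1, mul_one]
      exact (mem_ball_iff_norm.1 ht).le
  set G : ℕ → ℝ → ℝ := fun i t => ∫ y, f y * Ψ i (y + t • e) with hG
  have hGc : Continuous (G 0) := continuous_iff_continuousAt.2 fun t₀ => by
    obtain ⟨b, hb, hle⟩ := hdom 0 (Nat.zero_le n) t₀
    refine continuousAt_of_dominated (bound := b)
      (Filter.Eventually.of_forall fun t => (hfΨ 0 (Nat.zero_le n) t).aestronglyMeasurable)
      ?_ hb (Filter.Eventually.of_forall fun y => ?_)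
    · filter_upwards [Metric.ball_mem_nhds t₀ one_pos] with t ht
      exact Filter.Eventually.of_forall fun y => hle y t ht
    · exact (continuous_const.mul ((hΨc 0 (Nat.zero_le n)).comp (by fun_prop))).continuousAt
  have hGd : ∀ i < n, ∀ t, HasDerivAt (G (i + 1)) (G i t) t := by
    intro i hi t₀
    obtain ⟨b, hb, hle⟩ := hdom i hi.le t₀
    refine (hasDerivAt_integral_of_dominated_loc_of_deriv_le (bound := b)
      (Metric.ball_mem_nhds t₀ one_pos)
      (Filter.Eventually.of_forall fun t => (hfΨ (i + 1) hi t).aestronglyMeasurable)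
      (hfΨ (i + 1) hi t₀) (hfΨ i hi.le t₀).aestronglyMeasurable
      (Filter.Eventually.of_forall hle) hb (Filter.Eventually.of_forall fun y t _ => ?_)).2
    exact (hasDerivAt_tensorFn_update g m (hΘd i hi) y t).const_mul (f y)
  have hGe : ∀ i, ∀ t, G i t = ∫ x, f (x - t • e) * Ψ i x := by
    intro i t
    have := integral_sub_right_eq_self (μ := volume) (fun y => f y * Ψ i (y + t • e)) (t • e)
    simp only [sub_add_cancel] at this
    exact this.symm
  have hGb : ∀ i ≤ n, ∀ s ∈ Set.Icc (0 : ℝ) n, ∀ t,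
      |((fwdDiff s)^[n] (G i)) t| ≤ ε * ∫ x, |Ψ i x| := by
    intro i hi s hs t
    have e1 : G i = fun t => ∫ x, f (x - t • e) * Ψ i x := funext (hGe i)
    have hint : ∀ t : ℝ, Integrable fun x => f (x - t • e) * Ψ i x := fun t => by
      have hm := aestronglyMeasurable_comp_smul_add hf one_ne_zero (-(t • e))
      simp only [one_smul, ← sub_eq_add_neg] at hm
      exact (hΨi i hi).bdd_mul hm (Filter.Eventually.of_forall fun x => hB _)
    rw [e1, fwdDiff_iter_integral hint, ← integral_const_mul, ← Real.norm_eq_abs]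
    refine norm_integral_le_of_norm_le ((hΨi i hi).abs.const_mul ε)
      (Filter.Eventually.of_forall fun x => ?_)
    rw [fwdDiff_iter_mul_const (fun t : ℝ => f (x - t • e)), norm_mul]
    refine mul_le_mul_of_nonneg_right ?_ (norm_nonneg _)
    rw [fwdDiff_iter_comp (g := fun t : ℝ => x - t • e) (h' := -(s • e))
      (fun t => by module) f n t]
    refine hε _ ?_ _
    rw [norm_neg, norm_smul, he1, mul_one, Real.norm_eq_abs, abs_of_nonneg hs.1]
    exact hs.2
  have h0 : 0 ≤ ∫ x, |Ψ 0 x| := integral_nonneg fun x => abs_nonneg _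
  have hn : 0 ≤ ∫ x, |Ψ n x| := integral_nonneg fun x => abs_nonneg _
  have h := abs_le_of_abs_fwdDiff_iter_le hGc hGd (ε := ε * ((∫ x, |Ψ 0 x|) + ∫ x, |Ψ n x|))
    (fun s hs t => (hGb 0 (Nat.zero_le n) s hs t).trans
      (mul_le_mul_of_nonneg_left (by linarith) hε0))
    (fun s hs t => (hGb n le_rfl s hs t).trans
      (mul_le_mul_of_nonneg_left (by linarith) hε0)) 0
  have e2 : G 0 0 = ∫ x, f x * tensorFn g x := by simp [hG, hΨ0]
  rw [e2] at h
  linarith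

theorem inner_waveletBasis {d M : ℕ} {φ ψ : ℝ → ℝ} (hw : IsWaveletBasis d M φ ψ)
    (a b : WaveletIndex d) :
    ∫ x, waveletFamily φ ψ a x * waveletFamily φ ψ b x = if a = b then 1 else 0 := by
  obtain ⟨β, hβ⟩ := hw.isBasis
  have h := orthonormal_iff_ite.1 β.orthonormal b a
  rw [L2.inner_def] at h
  simp only [eq_comm (a := b)] at h
  rw [← h]
  refine integral_congr_ae ?_
  filter_upwards [hβ a, hβ b] with x ha hb
  rw [ha, hb]
  simp

/-- The type `(1, …, 1)`. -/
def fullType {d : ℕ} (hd : 1 ≤ d) : WaveletType d :=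
  ⟨fun _ => true, fun h => by simpa using congrFun h ⟨0, hd⟩⟩

/-- Orthogonality of `ψ` to its finer dilates, read off from the diagonal wavelets
`ψ ⊗ ⋯ ⊗ ψ`, whose inner products are `d`-th powers of one-dimensional ones. -/
theorem IsWaveletBasis.integral_mul_dilate_eq_zero {d M : ℕ} (hd : 1 ≤ d) {φ ψ : ℝ → ℝ}
    (hw : IsWaveletBasis d M φ ψ) (J : ℕ) (hJ : 1 ≤ J) (k : ℤ) :
    ∫ x, ψ x * ψ (2 ^ J * x - k) = 0 := by
  have h := inner_waveletBasis hw (Sum.inr (0, fullType hd, 0))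
    (Sum.inr (J, fullType hd, fun _ => k))
  rw [if_neg (by simp; omega)] at h
  have e : ∀ x : EuclideanSpace ℝ (Fin d),
      waveletFamily φ ψ (Sum.inr (0, fullType hd, 0)) x
        * waveletFamily φ ψ (Sum.inr (J, fullType hd, fun _ => k)) x
      = √(2 ^ (d * J)) * tensorFn (fun _ t => ψ t * ψ (2 ^ J * t - k)) x := by
    intro x
    simp only [waveletFamily, tensorWavelet, tensorFn, fullType, Finset.prod_mul_distrib]
    simp
    ring
  simp_rw [e] at h
  rw [integral_const_mul, integral_tensorFn, Finset.prod_const] at h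
  have h2 : √(2 ^ (d * J) : ℝ) ≠ 0 := by positivity
  exact eq_zero_of_pow_eq_zero ((mul_eq_zero.1 h).resolve_left h2)

theorem IsWaveletBasis.exists_ne_zero {d M : ℕ} (hd : 1 ≤ d) {φ ψ : ℝ → ℝ}
    (hw : IsWaveletBasis d M φ ψ) : ∃ x, ψ x ≠ 0 := by
  by_contra! h
  have h1 := inner_waveletBasis hw (Sum.inr (0, fullType hd, 0)) (Sum.inr (0, fullType hd, 0))
  have : Nonempty (Fin d) := ⟨⟨0, hd⟩⟩
  simp [waveletFamily, tensorWavelet, fullType, h, Finset.card_univ, zero_pow (by omega : d ≠ 0)]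
    at h1

theorem IsWaveletBasis.primitive_properties {d M : ℕ} (hd : 1 ≤ d) {φ ψ : ℝ → ℝ}
    (hw : IsWaveletBasis d M φ ψ) :
    (∀ i ≤ M, Continuous (primitive ψ i)) ∧ (∀ i ≤ M, RapidDecay (primitive ψ i)) ∧
      ∀ i < M, ∀ x, HasDerivAt (primitive ψ (i + 1)) (primitive ψ i x) x := by
  have h := fun {n : ℕ} (hn : n ≤ M) => _root_.primitive_properties hw.contDiff_wavelet
    hw.decay_wavelet (hw.exists_ne_zero hd) (hw.integral_mul_dilate_eq_zero hd) hn
  exact ⟨fun i hi => (h hi).1, fun i hi => (h hi).2.1, (h le_rfl).2.2.2⟩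

theorem IsWaveletBasis.contDiff_typeFactors {d M : ℕ} {φ ψ : ℝ → ℝ}
    (hw : IsWaveletBasis d M φ ψ) (i : Fin d → Bool) (m : Fin d) :
    ContDiff ℝ M (typeFactors φ ψ i m) := by
  unfold typeFactors
  split_ifs
  exacts [hw.contDiff_wavelet, hw.contDiff_scaling]

theorem IsWaveletBasis.fastDecay_typeFactors {d M : ℕ} {φ ψ : ℝ → ℝ}
    (hw : IsWaveletBasis d M φ ψ) (i : Fin d → Bool) (m : Fin d) :
    FastDecay M (typeFactors φ ψ i m) := by
  unfold typeFactors
  split_ifs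
  exacts [hw.decay_wavelet, hw.decay_scaling]

theorem IsWaveletBasis.continuous_typeFactors {d M : ℕ} {φ ψ : ℝ → ℝ}
    (hw : IsWaveletBasis d M φ ψ) (i : Fin d → Bool) (m : Fin d) :
    Continuous (typeFactors φ ψ i m) := (hw.contDiff_typeFactors i m).continuous

theorem IsWaveletBasis.rapidDecay_typeFactors {d M : ℕ} {φ ψ : ℝ → ℝ}
    (hw : IsWaveletBasis d M φ ψ) (i : Fin d → Bool) (m : Fin d) :
    RapidDecay (typeFactors φ ψ i m) := fun N => by
  simpa using hw.fastDecay_typeFactors i m 0 (Nat.zero_le M) N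

theorem WaveletType.exists_eq_true {d : ℕ} (i : WaveletType d) : ∃ m, i.1 m = true := by
  by_contra! h
  exact i.2 (funext fun m => by simpa using h m)

theorem two_pow_mul_integral_tensorWavelet {d : ℕ} (φ ψ : ℝ → ℝ)
    (f : EuclideanSpace ℝ (Fin d) → ℝ) (i : Fin d → Bool) (j : ℕ) (k : Fin d → ℤ) :
    2 ^ (d * j) * ∫ x, f x * tensorWavelet φ ψ i j k x
      = ∫ y, f (((2 : ℝ) ^ j)⁻¹ • y + ((2 : ℝ) ^ j)⁻¹ • latticePoint k) *
        tensorFn (typeFactors φ ψ i) y := by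
  rw [tensorWavelet_eq]
  set F : EuclideanSpace ℝ (Fin d) → ℝ := fun y =>
    f (((2 : ℝ) ^ j)⁻¹ • y + ((2 : ℝ) ^ j)⁻¹ • latticePoint k) * tensorFn (typeFactors φ ψ i) y
    with hF
  have h2 : (2 : ℝ) ^ j ≠ 0 := by positivity
  have e : ∀ x, f x * tensorFn (typeFactors φ ψ i) ((2 : ℝ) ^ j • x - latticePoint k)
      = F ((2 : ℝ) ^ j • x - latticePoint k) := by
    intro x
    simp only [hF]
    rw [← smul_add, sub_add_cancel, smul_smul, inv_mul_cancel₀ h2, one_smul]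
  simp_rw [e]
  rw [Measure.integral_comp_smul volume (fun z => F (z - latticePoint k)),
    integral_sub_right_eq_self F, finrank_euclideanSpace_fin, smul_eq_mul,
    abs_of_pos (by positivity), mul_comm d j, pow_mul]
  field_simp

/-- The wavelet coefficients at scale `2^{-j}` of a bounded function are at most a multiple of its
modulus of smoothness there. -/
theorem IsWaveletBasis.exists_abs_waveletCoeff_le {d M : ℕ} (hd : 1 ≤ d) {φ ψ : ℝ → ℝ}
    (hw : IsWaveletBasis d M φ ψ) :
    ∃ C, 0 ≤ C ∧ ∀ (f : EuclideanSpace ℝ (Fin d) → ℝ) (B : ℝ), AEStronglyMeasurable f →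
      (∀ x, |f x| ≤ B) → ∀ i j k,
        |waveletCoeff φ ψ f i j k| ≤ C * modulusOfSmoothness M f ((2 : ℝ) ^ j)⁻¹ := by
  obtain ⟨hpc, hpr, hpd⟩ := hw.primitive_properties hd
  have h1 : ∀ i : WaveletType d, ∃ C, 0 ≤ C ∧
      ∀ (f : EuclideanSpace ℝ (Fin d) → ℝ) (B ε : ℝ), AEStronglyMeasurable f →
      (∀ x, |f x| ≤ B) → (∀ h, ‖h‖ ≤ M → ∀ x, |((fwdDiff h)^[M] f) x| ≤ ε) →
      |∫ x, f x * tensorFn (typeFactors φ ψ i.1) x| ≤ C * ε := by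
    intro i
    obtain ⟨m, hm⟩ := i.exists_eq_true
    exact exists_abs_integral_mul_tensorFn_le (hw.continuous_typeFactors i.1)
      (hw.rapidDecay_typeFactors i.1) m (Θ := primitive ψ) (by simp [primitive, typeFactors, hm])
      hpc hpr hpd
  choose C hC0 hC using h1
  refine ⟨(∑ i, C i) * 2 ^ (M * M), mul_nonneg (Finset.sum_nonneg fun i _ => hC0 i)
    (by positivity), fun f B hf hB i j k => ?_⟩
  rw [waveletCoeff, two_pow_mul_integral_tensorWavelet]
  have hj : (0 : ℝ) < ((2 : ℝ) ^ j)⁻¹ := by positivity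
  have hω := modulusOfSmoothness_nonneg f M ((2 : ℝ) ^ j)⁻¹
  have h2 := hC i (fun y => f (((2 : ℝ) ^ j)⁻¹ • y + ((2 : ℝ) ^ j)⁻¹ • latticePoint k)) B
    (2 ^ (M * M) * modulusOfSmoothness M f ((2 : ℝ) ^ j)⁻¹)
    (aestronglyMeasurable_comp_smul_add hf hj.ne' _) (fun x => hB _) (fun h hh x => by
      rw [fwdDiff_iter_comp (h' := ((2 : ℝ) ^ j)⁻¹ • h)
        (g := fun y => ((2 : ℝ) ^ j)⁻¹ • y + ((2 : ℝ) ^ j)⁻¹ • latticePoint k)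
        (fun x => by module)]
      refine (abs_fwdDiff_iter_le_modulusOfSmoothness hB M ?_ _).trans
        (modulusOfSmoothness_two_pow_mul_le hB M M _)
      rw [norm_smul, Real.norm_of_nonneg hj.le, mul_comm]
      gcongr
      exact hh.trans (by exact_mod_cast Nat.lt_two_pow_self.le))
  refine h2.trans ?_
  rw [mul_assoc]
  refine mul_le_mul_of_nonneg_right ?_ (by positivity)
  exact Finset.single_le_sum (fun i _ => hC0 i) (Finset.mem_univ i)

/-! ### The wavelet expansion of a bounded function -/

theorem IsWaveletBasis.continuous_tensorWavelet {d M : ℕ} {φ ψ : ℝ → ℝ}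
    (hw : IsWaveletBasis d M φ ψ) (i : Fin d → Bool) (j : ℕ) (k : Fin d → ℤ) :
    Continuous (tensorWavelet φ ψ i j k) := by
  rw [tensorWavelet_eq]
  exact (continuous_tensorFn (hw.continuous_typeFactors i)).comp (by fun_prop)

theorem IsWaveletBasis.integrable_typeFactors {d M : ℕ} {φ ψ : ℝ → ℝ}
    (hw : IsWaveletBasis d M φ ψ) (i : Fin d → Bool) :
    Integrable (tensorFn (typeFactors φ ψ i)) :=
  integrable_tensorFn fun m =>
    (hw.rapidDecay_typeFactors i m).integrable (hw.continuous_typeFactors i m)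

theorem IsWaveletBasis.integrable_tensorWavelet {d M : ℕ} {φ ψ : ℝ → ℝ}
    (hw : IsWaveletBasis d M φ ψ) (i : Fin d → Bool) (j : ℕ) (k : Fin d → ℤ) :
    Integrable (tensorWavelet φ ψ i j k) := by
  rw [tensorWavelet_eq]
  exact ((hw.integrable_typeFactors i).comp_sub_right (latticePoint k)).comp_smul
    (by positivity : (2 : ℝ) ^ j ≠ 0)

theorem IsWaveletBasis.exists_abs_tensorWavelet_le {d M : ℕ} {φ ψ : ℝ → ℝ}
    (hw : IsWaveletBasis d M φ ψ) (i : Fin d → Bool) (j : ℕ) (k : Fin d → ℤ) :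
    ∃ K, ∀ x, |tensorWavelet φ ψ i j k x| ≤ K := by
  obtain ⟨K, hK0, hK⟩ := exists_abs_tensorFn_le (hw.rapidDecay_typeFactors i)
  refine ⟨K, fun x => ?_⟩
  rw [tensorWavelet_eq]
  exact (hK _).trans (mul_le_of_le_one_right hK0 (tensorWeight_le_one _))

/-- The type of a basis function; the translates of the scaling function have type `0`. -/
def indexType {d : ℕ} : WaveletIndex d → Fin d → Bool
  | Sum.inl _ => fun _ => false
  | Sum.inr (_, i, _) => i.1

/-- The scale of a basis function; the translates of the scaling function have scale `0`. -/
def indexScale {d : ℕ} : WaveletIndex d → ℕ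
  | Sum.inl _ => 0
  | Sum.inr (j, _, _) => j

/-- The position of a basis function. -/
def indexPos {d : ℕ} : WaveletIndex d → Fin d → ℤ
  | Sum.inl k => k
  | Sum.inr (_, _, k) => k

theorem waveletFamily_eq {d : ℕ} (φ ψ : ℝ → ℝ) (n : WaveletIndex d) :
    waveletFamily φ ψ n = fun x => √(2 ^ (d * indexScale n)) *
      tensorWavelet φ ψ (indexType n) (indexScale n) (indexPos n) x := by
  rcases n with k | ⟨j, i, k⟩
  · simp [waveletFamily, indexScale, indexType, indexPos]
  · rfl

/-- The pairing of `η` with a basis function, in `L¹` normalisation. -/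
noncomputable def pairing {d : ℕ} (φ ψ : ℝ → ℝ) (η : EuclideanSpace ℝ (Fin d) → ℝ)
    (n : WaveletIndex d) : ℝ :=
  ∫ x, η x * tensorWavelet φ ψ (indexType n) (indexScale n) (indexPos n) x

/-- The coefficients of `f` in `L^∞` normalisation: those of the scaling function at scale `0`
and the wavelet coefficients. -/
noncomputable def basisCoeff {d : ℕ} (φ ψ : ℝ → ℝ) (f : EuclideanSpace ℝ (Fin d) → ℝ)
    (n : WaveletIndex d) : ℝ :=
  2 ^ (d * indexScale n) * pairing φ ψ f n

/-- A common bound for the `L¹` norms of the tensor product functions. -/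
noncomputable def waveletMass (d : ℕ) (φ ψ : ℝ → ℝ) : ℝ :=
  ∑ i : Fin d → Bool, ∫ x, |tensorFn (typeFactors φ ψ i) x|

theorem waveletMass_nonneg (d : ℕ) (φ ψ : ℝ → ℝ) : 0 ≤ waveletMass d φ ψ :=
  Finset.sum_nonneg fun _ _ => integral_nonneg fun _ => abs_nonneg _

theorem IsWaveletBasis.abs_two_pow_mul_integral_le {d M : ℕ} {φ ψ : ℝ → ℝ}
    (hw : IsWaveletBasis d M φ ψ) {f : EuclideanSpace ℝ (Fin d) → ℝ} {B : ℝ}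
    (hB : ∀ x, |f x| ≤ B) (i : Fin d → Bool) (j : ℕ) (k : Fin d → ℤ) :
    |2 ^ (d * j) * ∫ x, f x * tensorWavelet φ ψ i j k x| ≤ B * waveletMass d φ ψ := by
  have hB0 : 0 ≤ B := (abs_nonneg _).trans (hB 0)
  rw [two_pow_mul_integral_tensorWavelet]
  have h1 : |∫ y, f (((2 : ℝ) ^ j)⁻¹ • y + ((2 : ℝ) ^ j)⁻¹ • latticePoint k) *
      tensorFn (typeFactors φ ψ i) y| ≤ ∫ y, B * |tensorFn (typeFactors φ ψ i) y| := by
    rw [← Real.norm_eq_abs]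
    refine norm_integral_le_of_norm_le ((hw.integrable_typeFactors i).abs.const_mul B)
      (Filter.Eventually.of_forall fun y => ?_)
    rw [norm_mul]
    exact mul_le_mul_of_nonneg_right (hB _) (norm_nonneg _)
  rw [integral_const_mul] at h1
  refine h1.trans (mul_le_mul_of_nonneg_left ?_ hB0)
  exact Finset.single_le_sum (f := fun i => ∫ x, |tensorFn (typeFactors φ ψ i) x|)
    (fun _ _ => integral_nonneg fun _ => abs_nonneg _) (Finset.mem_univ i)

/-- Pairing a bounded function `f` with a test function `η` through the wavelet basis, provided the
coefficients of `η` are absolutely summable. For `f` in `L²` this is Parseval's identity; the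
general case follows by truncating `f` to large balls. -/
theorem IsWaveletBasis.integral_mul_eq_tsum {d M : ℕ} {φ ψ : ℝ → ℝ} (hw : IsWaveletBasis d M φ ψ)
    {f η : EuclideanSpace ℝ (Fin d) → ℝ} {B : ℝ} (hf : AEStronglyMeasurable f)
    (hB : ∀ x, |f x| ≤ B) (hηc : Continuous η) (hηs : HasCompactSupport η)
    (hsum : Summable (pairing φ ψ η)) :
    ∫ x, f x * η x = ∑' n, pairing φ ψ η n * basisCoeff φ ψ f n := by
  obtain ⟨b, hb⟩ := hw.isBasis
  set fR : ℕ → EuclideanSpace ℝ (Fin d) → ℝ := fun R => (Metric.ball 0 (R : ℝ)).indicator f with hfR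
  have hfRm : ∀ R, AEStronglyMeasurable (fR R) := fun R => hf.indicator measurableSet_ball
  have hfRB : ∀ R x, |fR R x| ≤ B := fun R x => by
    by_cases hx : x ∈ Metric.ball (0 : EuclideanSpace ℝ (Fin d)) (R : ℝ)
    · simpa [hfR, Set.indicator_of_mem hx] using hB x
    · simpa [hfR, Set.indicator_of_notMem hx] using (abs_nonneg _).trans (hB 0)
  have hfR2 : ∀ R, MemLp (fR R) 2 := fun R => by
    rw [hfR, memLp_indicator_iff_restrict measurableSet_ball]
    have : IsFiniteMeasure
        (volume.restrict (Metric.ball (0 : EuclideanSpace ℝ (Fin d)) (R : ℝ))) :=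
      ⟨by rw [Measure.restrict_apply_univ]; exact measure_ball_lt_top⟩
    exact MemLp.of_bound hf.restrict B (Filter.Eventually.of_forall hB)
  have hη2 : MemLp η 2 := hηc.memLp_of_hasCompactSupport hηs
  have hpars : ∀ R, ∑' n, pairing φ ψ η n * basisCoeff φ ψ (fR R) n = ∫ x, fR R x * η x := by
    intro R
    have h1 := b.hasSum_inner_mul_inner ((hfR2 R).toLp) (hη2.toLp)
    have h2 : inner ℝ ((hfR2 R).toLp) (hη2.toLp) = ∫ x, fR R x * η x := by
      rw [L2.inner_def]
      refine integral_congr_ae ?_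
      filter_upwards [(hfR2 R).coeFn_toLp, hη2.coeFn_toLp] with x h1 h2
      rw [h1, h2]
      simp [mul_comm]
    have h3 : ∀ n, inner ℝ ((hfR2 R).toLp) (b n) = ∫ x, fR R x * waveletFamily φ ψ n x := by
      intro n
      rw [L2.inner_def]
      refine integral_congr_ae ?_
      filter_upwards [(hfR2 R).coeFn_toLp, hb n] with x h1 h2
      rw [h1, h2]
      simp [mul_comm]
    have h4 : ∀ n, inner ℝ (b n) (hη2.toLp) = ∫ x, η x * waveletFamily φ ψ n x := by
      intro n
      rw [L2.inner_def]
      refine integral_congr_ae ?_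
      filter_upwards [hη2.coeFn_toLp, hb n] with x h1 h2
      rw [h1, h2]
      simp
    rw [h2] at h1
    rw [← h1.tsum_eq]
    refine tsum_congr fun n => ?_
    rw [h3, h4, waveletFamily_eq]
    simp only [mul_left_comm _ (√(2 ^ (d * indexScale n)) : ℝ)]
    rw [integral_const_mul, integral_const_mul, basisCoeff, pairing, pairing]
    have h5 : √(2 ^ (d * indexScale n) : ℝ) * √(2 ^ (d * indexScale n)) = 2 ^ (d * indexScale n) :=
      Real.mul_self_sqrt (by positivity)
    have h6 : ∀ P Q s t : ℝ, s * s = t → P * (t * Q) = s * Q * (s * P) := by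
      rintro P Q s t rfl
      ring
    exact h6 _ _ _ _ h5
  have hlim : Filter.Tendsto (fun R => ∑' n, pairing φ ψ η n * basisCoeff φ ψ (fR R) n)
      Filter.atTop (nhds (∑' n, pairing φ ψ η n * basisCoeff φ ψ f n)) := by
    refine tendsto_tsum_of_dominated_convergence
      (bound := fun n => ‖pairing φ ψ η n‖ * (B * waveletMass d φ ψ))
      (hsum.norm.mul_right _) (fun n => ?_) (Filter.Eventually.of_forall fun R n => ?_)
    · refine Filter.Tendsto.const_mul _ (Filter.Tendsto.const_mul _ ?_)
      have hi := hw.integrable_tensorWavelet (indexType n) (indexScale n) (indexPos n)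
      refine tendsto_integral_of_dominated_convergence
        (fun x => B * ‖tensorWavelet φ ψ (indexType n) (indexScale n) (indexPos n) x‖)
        (fun R => (hfRm R).mul hi.aestronglyMeasurable) (hi.norm.const_mul B)
        (fun R => Filter.Eventually.of_forall fun x => ?_)
        (Filter.Eventually.of_forall fun x => ?_)
      · rw [norm_mul]
        exact mul_le_mul_of_nonneg_right (hfRB R x) (norm_nonneg _)
      · refine tendsto_const_nhds.congr' ?_
        filter_upwards [tendsto_natCast_atTop_atTop.eventually_gt_atTop ‖x‖] with R hR
        simp only [hfR]
        rw [Set.indicator_of_mem (mem_ball_zero_iff.2 hR)]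
    · rw [norm_mul]
      exact mul_le_mul_of_nonneg_left (hw.abs_two_pow_mul_integral_le (hfRB R) _ _ _)
        (norm_nonneg _)
  refine tendsto_nhds_unique (tendsto_const_nhds.congr' ?_) hlim
  obtain ⟨R₀, hR₀⟩ := hηs.isCompact.isBounded.subset_ball (0 : EuclideanSpace ℝ (Fin d))
  filter_upwards [tendsto_natCast_atTop_atTop.eventually_ge_atTop R₀] with R hR
  rw [hpars]
  refine integral_congr_ae (Filter.Eventually.of_forall fun x => ?_)
  by_cases hx : η x = 0
  · simp [hx]
  · have : x ∈ Metric.ball (0 : EuclideanSpace ℝ (Fin d)) (R : ℝ) :=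
      Metric.ball_subset_ball hR (hR₀ (subset_tsupport η hx))
    simp only [hfR]
    rw [Set.indicator_of_mem this]

theorem summable_of_tsum_enorm_ne_top {ι : Type*} {a : ι → ℝ} (h : ∑' n, ‖a n‖ₑ ≠ ⊤) :
    Summable a := by
  exact Summable.of_norm (NNReal.summable_coe.2
    (ENNReal.tsum_coe_ne_top_iff_summable (f := fun n => ‖a n‖₊) |>.1 h))

theorem tsum_waveletIndex {d : ℕ} (F : WaveletIndex d → ENNReal) :
    ∑' n, F n = ∑' k, F (Sum.inl k) + ∑' j, ∑ i, ∑' k, F (Sum.inr (j, i, k)) := by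
  rw [Summable.tsum_sum ENNReal.summable ENNReal.summable, ENNReal.tsum_prod']
  congr 1
  refine tsum_congr fun j => ?_
  rw [ENNReal.tsum_prod', tsum_fintype]

theorem IsWaveletBasis.tsum_enorm_integral_tensorWavelet_le {d M : ℕ} {φ ψ : ℝ → ℝ}
    (hw : IsWaveletBasis d M φ ψ) (i : Fin d → Bool) : ∃ C, 0 ≤ C ∧
      ∀ θ : EuclideanSpace ℝ (Fin d) → ℝ, AEStronglyMeasurable θ → ∀ j,
        ∑' k, ‖∫ x, θ x * tensorWavelet φ ψ i j k x‖ₑ ≤ ENNReal.ofReal C * ∫⁻ x, ‖θ x‖ₑ := by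
  obtain ⟨K, hK0, hK⟩ := exists_abs_tensorFn_le (hw.rapidDecay_typeFactors i)
  refine ⟨K * (latticeBound d).toReal, by positivity, fun θ hθ j => ?_⟩
  rw [ENNReal.ofReal_mul hK0, ENNReal.ofReal_toReal (latticeBound_ne_top d)]
  simp_rw [tensorWavelet_eq]
  exact tsum_enorm_integral_le hθ hK0 hK _

/-- Integrating by parts in a direction `m` with `i m = 1`, the coefficients at scale `2^{-j}` of a
test function gain a factor `2^{-j}`. -/
theorem IsWaveletBasis.exists_tsum_enorm_le_of_contDiff {d M : ℕ} (hd : 1 ≤ d) (hM : 1 ≤ M)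
    {φ ψ : ℝ → ℝ} (hw : IsWaveletBasis d M φ ψ) (i : WaveletType d)
    {η : EuclideanSpace ℝ (Fin d) → ℝ} (hη : ContDiff ℝ 1 η) (hηs : HasCompactSupport η) :
    ∃ D : ENNReal, D ≠ ⊤ ∧ ∀ j,
      ∑' k, ‖∫ x, η x * tensorWavelet φ ψ i.1 j k x‖ₑ ≤ (2⁻¹) ^ j * D := by
  obtain ⟨m, hm⟩ := i.exists_eq_true
  obtain ⟨hpc, hpr, hpd⟩ := hw.primitive_properties hd
  set e : EuclideanSpace ℝ (Fin d) := EuclideanSpace.single m 1 with he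
  set Ψ := tensorFn (Function.update (typeFactors φ ψ i.1) m (primitive ψ 1)) with hΨ
  have hΨc : Continuous Ψ := continuous_tensorFn fun m' => by
    rcases eq_or_ne m' m with rfl | h
    · simpa using hpc 1 hM
    · simpa [Function.update_of_ne h] using hw.continuous_typeFactors i.1 m'
  obtain ⟨K, hK0, hK⟩ : ∃ K, 0 ≤ K ∧ ∀ x, |Ψ x| ≤ K * tensorWeight x :=
    exists_abs_tensorFn_le fun m' => by
      rcases eq_or_ne m' m with rfl | h
      · simpa using hpr 1 hM
      · simpa [Function.update_of_ne h] using hw.rapidDecay_typeFactors i.1 m'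
  set η' : EuclideanSpace ℝ (Fin d) → ℝ := fun x => fderiv ℝ η x e with hη'
  have hη'c : Continuous η' := (hη.continuous_fderiv (by norm_num)).clm_apply continuous_const
  have hη's : HasCompactSupport η' := hηs.fderiv_apply ℝ e
  have hη'i : Integrable η' := hη'c.integrable_of_hasCompactSupport hη's
  refine ⟨ENNReal.ofReal K * latticeBound d * ∫⁻ x, ‖η' x‖ₑ, ?_, fun j => ?_⟩
  · exact ENNReal.mul_ne_top (ENNReal.mul_ne_top ENNReal.ofReal_ne_top (latticeBound_ne_top d))
      hη'i.2.ne
  have hparts : ∀ k : Fin d → ℤ, ∫ x, η x * tensorWavelet φ ψ i.1 j k x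
      = -((2 ^ j)⁻¹ * ∫ x, η' x * Ψ ((2 : ℝ) ^ j • x - latticePoint k)) := by
    intro k
    have hline : ∀ x, HasLineDerivAt ℝ (fun x => Ψ ((2 : ℝ) ^ j • x - latticePoint k))
        (tensorWavelet φ ψ i.1 j k x * 2 ^ j) x e := by
      intro x
      have h1 := hasDerivAt_tensorFn_update (typeFactors φ ψ i.1) m (hpd 0 hM)
        ((2 : ℝ) ^ j • x - latticePoint k) (2 ^ j * 0)
      have h2 : HasDerivAt (fun t : ℝ => (2 : ℝ) ^ j * t) (2 ^ j) 0 := by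
        simpa using (hasDerivAt_id (0 : ℝ)).const_mul ((2 : ℝ) ^ j)
      have h3 := HasDerivAt.comp (h₂ := fun t : ℝ => Ψ ((2 : ℝ) ^ j • x - latticePoint k + t • e))
        0 h1 h2
      have h4 : Function.update (typeFactors φ ψ i.1) m (primitive ψ 0) = typeFactors φ ψ i.1 := by
        rw [Function.update_eq_self_iff]
        simp [primitive, typeFactors, hm]
      rw [h4, mul_zero, zero_smul, add_zero] at h3
      have h5 : tensorWavelet φ ψ i.1 j k x
          = tensorFn (typeFactors φ ψ i.1) ((2 : ℝ) ^ j • x - latticePoint k) := by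
        rw [tensorWavelet_eq]
      rw [h5]
      refine h3.congr_of_eventuallyEq (Filter.Eventually.of_forall fun t => ?_)
      simp only [Function.comp]
      congr 1
      module
    have hΨk : Continuous fun x => Ψ ((2 : ℝ) ^ j • x - latticePoint k) := hΨc.comp (by fun_prop)
    have h := integral_bilinear_hasLineDerivAt_right_eq_neg_left_of_integrable
      (μ := (volume : Measure (EuclideanSpace ℝ (Fin d)))) (f := η) (f' := η')
      (g := fun x => Ψ ((2 : ℝ) ^ j • x - latticePoint k))
      (g' := fun x => tensorWavelet φ ψ i.1 j k x * 2 ^ j) (v := e)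
      (B := ContinuousLinearMap.mul ℝ ℝ)
      (by
        simp only [ContinuousLinearMap.mul_apply']
        exact (hη'c.mul hΨk).integrable_of_hasCompactSupport hη's.mul_right)
      (by
        simp only [ContinuousLinearMap.mul_apply']
        exact (hη.continuous.mul ((hw.continuous_tensorWavelet _ _ _).mul
          continuous_const)).integrable_of_hasCompactSupport hηs.mul_right)
      (by
        simp only [ContinuousLinearMap.mul_apply']
        exact (hη.continuous.mul hΨk).integrable_of_hasCompactSupport hηs.mul_right)
      (fun x _ => ((hη.differentiable (by norm_num)) x).hasFDerivAt.hasLineDerivAt e)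
      (fun x _ => hline x)
    simp only [ContinuousLinearMap.mul_apply', ← mul_assoc] at h
    rw [integral_mul_const] at h
    have h2 : (2 : ℝ) ^ j ≠ 0 := by positivity
    field_simp
    linarith
  have hterm : ∀ k : Fin d → ℤ, ‖∫ x, η x * tensorWavelet φ ψ i.1 j k x‖ₑ
      = (2⁻¹) ^ j * ‖∫ x, η' x * Ψ ((2 : ℝ) ^ j • x - latticePoint k)‖ₑ := by
    intro k
    rw [hparts, enorm_neg, enorm_mul]
    congr 1
    rw [← inv_pow, enorm_pow]
    congr 1
    rw [Real.enorm_eq_ofReal (by norm_num), ENNReal.ofReal_inv_of_pos (by norm_num)]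
    simp
  simp_rw [hterm, ENNReal.tsum_mul_left]
  gcongr
  exact tsum_enorm_integral_le hη'c.aestronglyMeasurable hK0 hK _

theorem IsWaveletBasis.summable_pairing {d M : ℕ} (hd : 1 ≤ d) (hM : 1 ≤ M)
    {φ ψ : ℝ → ℝ} (hw : IsWaveletBasis d M φ ψ)
    {η : EuclideanSpace ℝ (Fin d) → ℝ} (hη : ContDiff ℝ 1 η) (hηs : HasCompactSupport η) :
    Summable (pairing φ ψ η) := by
  refine summable_of_tsum_enorm_ne_top ?_
  rw [tsum_waveletIndex]
  refine ENNReal.add_ne_top.2 ⟨?_, ?_⟩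
  · obtain ⟨C, -, hC⟩ := hw.tsum_enorm_integral_tensorWavelet_le (fun _ : Fin d => false)
    refine ne_top_of_le_ne_top ?_ (hC η hη.continuous.aestronglyMeasurable 0)
    exact ENNReal.mul_ne_top ENNReal.ofReal_ne_top
      (hη.continuous.integrable_of_hasCompactSupport hηs).2.ne
  · choose D hDt hD using fun i => hw.exists_tsum_enorm_le_of_contDiff hd hM i hη hηs
    have h1 : ∑' j : ℕ, ∑ i, (2⁻¹ : ENNReal) ^ j * D i ≠ ⊤ := by
      simp_rw [← Finset.mul_sum, ENNReal.tsum_mul_right]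
      refine ENNReal.mul_ne_top ?_ (ENNReal.sum_ne_top.2 fun i _ => hDt i)
      rw [ENNReal.tsum_geometric]
      simp
    exact ne_top_of_le_ne_top h1
      (ENNReal.tsum_le_tsum fun j => Finset.sum_le_sum fun i _ => hD i j)

/-! ### Bounding the modulus of smoothness by the wavelet coefficients -/

theorem integrable_fwdDiff_iter {d : ℕ} {θ : EuclideanSpace ℝ (Fin d) → ℝ} (hθ : Integrable θ)
    (h : EuclideanSpace ℝ (Fin d)) (n : ℕ) : Integrable ((fwdDiff h)^[n] θ) := by
  induction n generalizing θ with
  | zero => exact hθ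
  | succ n ih =>
    rw [Function.iterate_succ_apply]
    exact ih ((hθ.comp_add_right h).sub hθ)

/-- Finite differences can be moved to the other factor of an integral. -/
theorem integral_mul_fwdDiff_iter_neg {d : ℕ} {F θ : EuclideanSpace ℝ (Fin d) → ℝ} {B : ℝ}
    (hF : AEStronglyMeasurable F) (hB : ∀ x, |F x| ≤ B) (hθ : Integrable θ)
    (h : EuclideanSpace ℝ (Fin d)) (n : ℕ) :
    ∫ x, F x * ((fwdDiff (-h))^[n] θ) x = ∫ x, ((fwdDiff h)^[n] F) x * θ x := by
  induction n generalizing F B with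
  | zero => rfl
  | succ n ih =>
    have hFh : AEStronglyMeasurable (fun x => F (x + h)) := by
      simpa using aestronglyMeasurable_comp_smul_add hF one_ne_zero h
    have hm : AEStronglyMeasurable (fwdDiff h F) := hFh.sub hF
    rw [Function.iterate_succ_apply', Function.iterate_succ_apply,
      ← ih hm fun x => abs_fwdDiff_iter_le hB h 1 x]
    set ζ := (fwdDiff (-h))^[n] θ with hζ
    have hi : Integrable ζ := integrable_fwdDiff_iter hθ _ n
    have h1 : Integrable fun x => F x * ζ x := hi.bdd_mul hF (Filter.Eventually.of_forall hB)
    have h2 : Integrable fun x => F x * ζ (x + -h) :=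
      (hi.comp_add_right (-h)).bdd_mul hF (Filter.Eventually.of_forall hB)
    have h3 : Integrable fun x => F (x + h) * ζ x :=
      hi.bdd_mul hFh (Filter.Eventually.of_forall fun x => hB _)
    have e : ∫ x, F x * ζ (x + -h) = ∫ x, F (x + h) * ζ x := by
      have := integral_add_right_eq_self (μ := volume) (fun x => F x * ζ (x + -h)) h
      simp only [add_neg_cancel_right] at this
      exact this.symm
    simp only [fwdDiff, mul_sub, sub_mul]
    rw [integral_sub h2 h1, integral_sub h3 h1, e]

theorem lintegral_enorm_fwdDiff_iter_le {d : ℕ} {θ : EuclideanSpace ℝ (Fin d) → ℝ}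
    (hθ : AEStronglyMeasurable θ) (h : EuclideanSpace ℝ (Fin d)) (n : ℕ) :
    ∫⁻ x, ‖((fwdDiff h)^[n] θ) x‖ₑ ≤ 2 ^ n * ∫⁻ x, ‖θ x‖ₑ := by
  induction n generalizing θ with
  | zero => simp
  | succ n ih =>
    have hθh : AEStronglyMeasurable (fun x => θ (x + h)) := by
      simpa using aestronglyMeasurable_comp_smul_add hθ one_ne_zero h
    rw [Function.iterate_succ_apply]
    refine (ih (hθh.sub hθ)).trans ?_
    rw [pow_succ, mul_assoc]
    gcongr
    calc ∫⁻ x, ‖fwdDiff h θ x‖ₑ ≤ ∫⁻ x, (‖θ (x + h)‖ₑ + ‖θ x‖ₑ) :=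
          lintegral_mono fun x => enorm_sub_le
      _ = (∫⁻ x, ‖θ (x + h)‖ₑ) + ∫⁻ x, ‖θ x‖ₑ := lintegral_add_left' hθh.enorm _
      _ = 2 * ∫⁻ x, ‖θ x‖ₑ := by
          rw [lintegral_add_right_eq_self (fun x => ‖θ x‖ₑ) h, two_mul]

theorem contDiff_fwdDiff_iter {d : ℕ} {θ : EuclideanSpace ℝ (Fin d) → ℝ} (hθ : ContDiff ℝ 1 θ)
    (h : EuclideanSpace ℝ (Fin d)) (n : ℕ) : ContDiff ℝ 1 ((fwdDiff h)^[n] θ) := by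
  induction n generalizing θ with
  | zero => exact hθ
  | succ n ih =>
    rw [Function.iterate_succ_apply]
    exact ih ((hθ.comp (contDiff_id.add contDiff_const)).sub hθ)

theorem hasCompactSupport_fwdDiff_iter {d : ℕ} {θ : EuclideanSpace ℝ (Fin d) → ℝ}
    (hθ : HasCompactSupport θ) (h : EuclideanSpace ℝ (Fin d)) (n : ℕ) :
    HasCompactSupport ((fwdDiff h)^[n] θ) := by
  induction n generalizing θ with
  | zero => exact hθ
  | succ n ih =>
    rw [Function.iterate_succ_apply]
    exact ih ((hθ.comp_homeomorph (Homeomorph.addRight h)).sub hθ)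

/-- A continuous function is bounded by `A` as soon as its integrals against bump functions are. -/
theorem le_of_forall_integral_mul_le {d : ℕ} {F : EuclideanSpace ℝ (Fin d) → ℝ} {A : ℝ}
    (hF : Continuous F)
    (h : ∀ θ : EuclideanSpace ℝ (Fin d) → ℝ, ContDiff ℝ 1 θ → HasCompactSupport θ →
      (∀ x, 0 ≤ θ x) → ∫ x, F x * θ x ≤ A * ∫ x, θ x) (x : EuclideanSpace ℝ (Fin d)) :
    F x ≤ A := by
  by_contra! hx
  obtain ⟨A', hA, hA'⟩ := exists_between hx
  obtain ⟨δ, hδ, hball⟩ := Metric.mem_nhds_iff.1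
    ((hF.tendsto x).eventually (lt_mem_nhds hA'))
  let θ : ContDiffBump x := ⟨δ / 2, δ, by positivity, by linarith⟩
  have h1 := h θ θ.contDiff θ.hasCompactSupport fun y => θ.nonneg
  have h2 : ∫ y, A' * θ y ≤ ∫ y, F y * θ y := by
    refine integral_mono ((θ.integrable (μ := volume)).const_mul A')
      ((hF.mul θ.continuous).integrable_of_hasCompactSupport θ.hasCompactSupport.mul_left)
      fun y => ?_
    by_cases hy : y ∈ Metric.ball x δ
    · exact mul_le_mul_of_nonneg_right (le_of_lt (hball hy)) θ.nonneg
    · have : θ y = 0 := θ.zero_of_le_dist (by simpa using hy)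
      simp [this]
  rw [integral_const_mul] at h2
  have h3 : 0 < ∫ y, θ y := θ.integral_pos
  have := lt_of_lt_of_le (mul_lt_mul_of_pos_right hA h3) h2
  linarith

/-- The coefficients of a finite difference of a test function: at scales coarser than the step the
cancellation of the difference acts on the basis functions. -/
theorem IsWaveletBasis.exists_tsum_enorm_fwdDiff_le {d M : ℕ} {φ ψ : ℝ → ℝ}
    (hw : IsWaveletBasis d M φ ψ) (i : Fin d → Bool) : ∃ C, 0 ≤ C ∧
      ∀ θ : EuclideanSpace ℝ (Fin d) → ℝ, Integrable θ → ∀ (h : EuclideanSpace ℝ (Fin d)) (j : ℕ),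
        ∑' k, ‖∫ x, ((fwdDiff (-h))^[M] θ) x * tensorWavelet φ ψ i j k x‖ₑ
          ≤ ENNReal.ofReal (C * min 1 ((2 ^ j * ‖h‖) ^ M)) * ∫⁻ x, ‖θ x‖ₑ := by
  obtain ⟨C₁, hC₁0, hC₁⟩ := hw.tsum_enorm_integral_tensorWavelet_le i
  obtain ⟨C₂, hC₂0, hC₂⟩ := exists_abs_fwdDiff_iter_tensorFn_le
    (hw.contDiff_typeFactors i) (hw.fastDecay_typeFactors i)
  refine ⟨2 ^ M * C₁ + C₂ * (latticeBound d).toReal, by positivity, fun θ hθ h j => ?_⟩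
  rcases le_total (2 ^ j * ‖h‖) 1 with hh | hh
  · have hn : ‖(2 : ℝ) ^ j • h‖ = 2 ^ j * ‖h‖ := by
      rw [norm_smul, Real.norm_of_nonneg (by positivity)]
    have hpow : (2 ^ j * ‖h‖) ^ M ≤ 1 := pow_le_one₀ (by positivity) hh
    rw [min_eq_right hpow]
    have e : ∀ k : Fin d → ℤ, ∫ x, ((fwdDiff (-h))^[M] θ) x * tensorWavelet φ ψ i j k x
        = ∫ x, θ x * ((fwdDiff ((2 : ℝ) ^ j • h))^[M] (tensorFn (typeFactors φ ψ i)))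
          ((2 : ℝ) ^ j • x - latticePoint k) := by
      intro k
      obtain ⟨K, hK⟩ := hw.exists_abs_tensorWavelet_le i j k
      have h1 := integral_mul_fwdDiff_iter_neg
        (hw.continuous_tensorWavelet i j k).aestronglyMeasurable hK hθ h M
      simp_rw [mul_comm (((fwdDiff (-h))^[M] θ) _), h1, mul_comm _ (θ _)]
      refine integral_congr_ae (Filter.Eventually.of_forall fun x => ?_)
      simp only
      rw [tensorWavelet_eq, fwdDiff_iter_comp (h' := (2 : ℝ) ^ j • h)
        (g := fun x => (2 : ℝ) ^ j • x - latticePoint k) (fun x => by module)]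
    simp_rw [e]
    refine (tsum_enorm_integral_le hθ.aestronglyMeasurable
      (K := C₂ * (2 ^ j * ‖h‖) ^ M) (by positivity) (fun x => ?_) _).trans ?_
    · rw [← hn]
      exact hC₂ _ (hn.trans_le hh) x
    · gcongr
      nth_rewrite 1 [← ENNReal.ofReal_toReal (latticeBound_ne_top d)]
      rw [← ENNReal.ofReal_mul (by positivity)]
      refine ENNReal.ofReal_le_ofReal ?_
      have : 0 ≤ 2 ^ M * C₁ * (2 ^ j * ‖h‖) ^ M := by positivity
      linarith
  · rw [min_eq_left (one_le_pow₀ hh), mul_one]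
    refine (hC₁ _ (integrable_fwdDiff_iter hθ (-h) M).aestronglyMeasurable j).trans ?_
    calc _ ≤ ENNReal.ofReal C₁ * (2 ^ M * ∫⁻ x, ‖θ x‖ₑ) := by
          gcongr
          exact lintegral_enorm_fwdDiff_iter_le hθ.aestronglyMeasurable _ _
      _ = ENNReal.ofReal (2 ^ M * C₁) * ∫⁻ x, ‖θ x‖ₑ := by
          rw [ENNReal.ofReal_mul (by positivity), ENNReal.ofReal_pow (by norm_num)]
          simp
          ring
      _ ≤ _ := by
          gcongr
          have : 0 ≤ C₂ * (latticeBound d).toReal := by positivity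
          linarith

/-- The modulus of smoothness of a bounded continuous function at `r` is controlled by a weighted
sum of bounds `u j` for its wavelet coefficients. By duality it suffices to pair the finite
difference of `f` with test functions `θ`; moving the difference to `θ` and expanding in the
wavelet basis separates the coefficients of `f` from those of the difference of `θ`. -/
theorem IsWaveletBasis.exists_modulusOfSmoothness_le {d M : ℕ} (hd : 1 ≤ d) (hM : 1 ≤ M)
    {φ ψ : ℝ → ℝ} (hw : IsWaveletBasis d M φ ψ) :
    ∃ C, 0 ≤ C ∧ ∀ (f : EuclideanSpace ℝ (Fin d) → ℝ) (B : ℝ), Continuous f → (∀ x, |f x| ≤ B) →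
      ∀ u : ℕ → ℝ, (∀ i j k, |waveletCoeff φ ψ f i j k| ≤ u j) → ∀ r : ℝ, 0 < r →
        Summable (fun j => u j * min 1 ((2 ^ j * r) ^ M)) →
        modulusOfSmoothness M f r ≤ C * (B * r ^ M + ∑' j, u j * min 1 ((2 ^ j * r) ^ M)) := by
  choose C hC0 hC using fun i : Fin d → Bool => hw.exists_tsum_enorm_fwdDiff_le i
  have hCs : 0 ≤ ∑ i, C i := Finset.sum_nonneg fun i _ => hC0 i
  have hCi : ∀ i, C i ≤ ∑ i, C i := fun i => Finset.single_le_sum (fun i _ => hC0 i)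
    (Finset.mem_univ i)
  set N := waveletMass d φ ψ with hN
  have hN0 : 0 ≤ N := waveletMass_nonneg d φ ψ
  set C' : ℝ := (∑ i, C i) * N + (Fintype.card (WaveletType d)) * ∑ i, C i with hC'
  have hC'0 : 0 ≤ C' := by positivity
  refine ⟨C', hC'0, fun f B hf hB u hu r hr hsum => ?_⟩
  have hB0 : 0 ≤ B := (abs_nonneg _).trans (hB 0)
  have hu0 : ∀ j, 0 ≤ u j := fun j =>
    (abs_nonneg _).trans (hu (fullType hd) j 0)
  set w : ℕ → ℝ := fun j => min 1 ((2 ^ j * r) ^ M) with hw'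
  have hw0 : ∀ j, 0 ≤ w j := fun j => by positivity
  set S : ℝ := ∑' j, u j * w j with hS
  have hS0 : 0 ≤ S := tsum_nonneg fun j => mul_nonneg (hu0 j) (hw0 j)
  set A : ℝ := C' * (B * r ^ M + S) with hA
  have hA0 : 0 ≤ A := by positivity
  refine modulusOfSmoothness_le hA0 fun h hh x => ?_
  have key : ∀ θ : EuclideanSpace ℝ (Fin d) → ℝ, ContDiff ℝ 1 θ → HasCompactSupport θ →
      (∀ x, 0 ≤ θ x) → |∫ x, ((fwdDiff h)^[M] f) x * θ x| ≤ A * ∫ x, θ x := by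
    intro θ hθ hθs hθ0
    have hθi : Integrable θ := hθ.continuous.integrable_of_hasCompactSupport hθs
    set η := (fwdDiff (-h))^[M] θ with hη
    have hηd : ContDiff ℝ 1 η := contDiff_fwdDiff_iter hθ _ _
    have hηs : HasCompactSupport η := hasCompactSupport_fwdDiff_iter hθs _ _
    rw [← integral_mul_fwdDiff_iter_neg hf.aestronglyMeasurable hB hθi h M,
      hw.integral_mul_eq_tsum hf.aestronglyMeasurable hB hηd.continuous hηs
        (hw.summable_pairing hd hM hηd hηs)]
    set I : ENNReal := ∫⁻ x, ‖θ x‖ₑ with hI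
    have hIr : I = ENNReal.ofReal (∫ x, θ x) := by
      rw [ofReal_integral_eq_lintegral_ofReal hθi (Filter.Eventually.of_forall hθ0)]
      exact lintegral_congr fun x => Real.enorm_eq_ofReal (hθ0 x)
    have hθI : 0 ≤ ∫ x, θ x := integral_nonneg hθ0
    have hscale : ∀ i j, ∑' k, ‖∫ x, η x * tensorWavelet φ ψ i j k x‖ₑ
        ≤ ENNReal.ofReal ((∑ i, C i) * w j) * I := by
      intro i j
      refine (hC i θ hθi h j).trans ?_
      gcongr
      · exact hCi i
      · exact min_le_min le_rfl (by gcongr)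
    have hlow : ∑' k, ‖pairing φ ψ η (Sum.inl k) * basisCoeff φ ψ f (Sum.inl k)‖ₑ
        ≤ ENNReal.ofReal ((∑ i, C i) * N * (B * r ^ M)) * I := by
      calc _ ≤ ∑' k, ‖∫ x, η x * tensorWavelet φ ψ (fun _ => false) 0 k x‖ₑ *
            ENNReal.ofReal (B * N) := by
            refine ENNReal.tsum_le_tsum fun k => ?_
            rw [enorm_mul]
            refine mul_le_mul' le_rfl ?_
            rw [Real.enorm_eq_ofReal_abs]
            exact ENNReal.ofReal_le_ofReal (hw.abs_two_pow_mul_integral_le hB _ _ _)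
        _ ≤ ENNReal.ofReal ((∑ i, C i) * w 0) * I * ENNReal.ofReal (B * N) := by
            rw [ENNReal.tsum_mul_right]
            gcongr
            exact hscale _ 0
        _ = ENNReal.ofReal ((∑ i, C i) * w 0 * (B * N)) * I := by
            rw [ENNReal.ofReal_mul (mul_nonneg hCs (hw0 0)) (q := B * N)]
            ring
        _ ≤ _ := by
            gcongr ENNReal.ofReal ?_ * I
            have : w 0 ≤ r ^ M := by simp [hw']
            calc _ ≤ (∑ i, C i) * r ^ M * (B * N) := by gcongr
              _ = _ := by ring
    have hhigh : ∑' j, ∑ i, ∑' k, ‖pairing φ ψ η (Sum.inr (j, i, k)) *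
        basisCoeff φ ψ f (Sum.inr (j, i, k))‖ₑ
          ≤ ENNReal.ofReal ((Fintype.card (WaveletType d)) * (∑ i, C i) * S) * I := by
      calc _ ≤ ∑' j, ∑ _i : WaveletType d, ENNReal.ofReal ((∑ i, C i) * w j) * I *
            ENNReal.ofReal (u j) := by
            refine ENNReal.tsum_le_tsum fun j => Finset.sum_le_sum fun i _ => ?_
            calc _ ≤ ∑' k, ‖∫ x, η x * tensorWavelet φ ψ i.1 j k x‖ₑ * ENNReal.ofReal (u j) := by
                  refine ENNReal.tsum_le_tsum fun k => ?_
                  rw [enorm_mul]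
                  refine mul_le_mul' le_rfl ?_
                  rw [Real.enorm_eq_ofReal_abs]
                  exact ENNReal.ofReal_le_ofReal (hu i j k)
              _ ≤ _ := by
                  rw [ENNReal.tsum_mul_right]
                  gcongr
                  exact hscale _ j
        _ = ∑' j, ENNReal.ofReal ((Fintype.card (WaveletType d)) * (∑ i, C i)) * I *
            ENNReal.ofReal (u j * w j) := by
            refine tsum_congr fun j => ?_
            rw [Finset.sum_const, Finset.card_univ, nsmul_eq_mul, ENNReal.ofReal_mul hCs,
              ENNReal.ofReal_mul (hu0 j), ENNReal.ofReal_mul (by positivity),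
              ENNReal.ofReal_natCast]
            ring
        _ = _ := by
            rw [ENNReal.tsum_mul_left, ← ENNReal.ofReal_tsum_of_nonneg
              (fun j => mul_nonneg (hu0 j) (hw0 j)) hsum, mul_right_comm,
              ← ENNReal.ofReal_mul (by positivity)]
    have htot : ‖∑' n, pairing φ ψ η n * basisCoeff φ ψ f n‖ₑ ≤ ENNReal.ofReal (A * ∫ x, θ x) := by
      refine enorm_tsum_le_tsum_enorm.trans ?_
      rw [tsum_waveletIndex]
      refine (add_le_add hlow hhigh).trans ?_
      rw [← add_mul, ← ENNReal.ofReal_add (by positivity) (by positivity), hIr,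
        ← ENNReal.ofReal_mul (by positivity)]
      refine ENNReal.ofReal_le_ofReal (mul_le_mul_of_nonneg_right ?_ hθI)
      rw [hA, hC']
      have h1 : 0 ≤ (∑ i, C i) * N * S := by positivity
      have h2 : 0 ≤ (Fintype.card (WaveletType d)) * (∑ i, C i) * (B * r ^ M) := by positivity
      linarith
    rw [Real.enorm_eq_ofReal_abs] at htot
    exact (ENNReal.ofReal_le_ofReal_iff (by positivity)).1 htot
  have hFc : Continuous ((fwdDiff h)^[M] f) := continuous_fwdDiff_iter hf h M
  refine abs_le'.2 ⟨le_of_forall_integral_mul_le hFc (fun θ h1 h2 h3 =>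
    (le_abs_self _).trans (key θ h1 h2 h3)) x,
    le_of_forall_integral_mul_le hFc.neg (fun θ h1 h2 h3 => ?_) x⟩
  have e : ∫ x, (-(fwdDiff h)^[M] f) x * θ x = -∫ x, ((fwdDiff h)^[M] f) x * θ x := by
    rw [← integral_neg]
    simp
  refine le_of_eq_of_le e ?_
  exact (neg_le_abs _).trans (key θ h1 h2 h3)

/-! ### Uniform bounds for the wavelet coefficients at each scale -/

theorem IsWaveletBasis.abs_waveletCoeff_le {d M : ℕ} {φ ψ : ℝ → ℝ} (hw : IsWaveletBasis d M φ ψ)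
    {f : EuclideanSpace ℝ (Fin d) → ℝ} {B : ℝ} (hB : ∀ x, |f x| ≤ B) (i : WaveletType d) (j : ℕ)
    (k : Fin d → ℤ) : |waveletCoeff φ ψ f i j k| ≤ B * waveletMass d φ ψ :=
  hw.abs_two_pow_mul_integral_le hB i.1 j k

theorem IsWaveletBasis.abs_waveletCoeff_le_coeffSup {d M : ℕ} {φ ψ : ℝ → ℝ}
    (hw : IsWaveletBasis d M φ ψ) {f : EuclideanSpace ℝ (Fin d) → ℝ} {B : ℝ}
    (hB : ∀ x, |f x| ≤ B) (i : WaveletType d) (j : ℕ) (k : Fin d → ℤ) :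
    |waveletCoeff φ ψ f i j k| ≤ coeffSup φ ψ f j := by
  have h1 : BddAbove (Set.range fun k => |waveletCoeff φ ψ f i j k|) :=
    ⟨B * waveletMass d φ ψ, by rintro _ ⟨k, rfl⟩; exact hw.abs_waveletCoeff_le hB i j k⟩
  refine (le_ciSup h1 k).trans ?_
  exact le_ciSup (f := fun i : WaveletType d => ⨆ k, |waveletCoeff φ ψ f i j k|)
    (Set.finite_range _).bddAbove i

theorem coeffSup_nonneg {d : ℕ} (φ ψ : ℝ → ℝ) (f : EuclideanSpace ℝ (Fin d) → ℝ) (j : ℕ) :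
    0 ≤ coeffSup φ ψ f j :=
  Real.iSup_nonneg fun _ => Real.iSup_nonneg fun _ => abs_nonneg _

theorem coeffSup_le {d : ℕ} {φ ψ : ℝ → ℝ} {f : EuclideanSpace ℝ (Fin d) → ℝ} {j : ℕ} {A : ℝ}
    (hA : 0 ≤ A) (h : ∀ i k, |waveletCoeff φ ψ f i j k| ≤ A) : coeffSup φ ψ f j ≤ A :=
  Real.iSup_le (fun i => Real.iSup_le (h i) hA) hA

/-- The maximum of the two suprema in `WaveletLowerBound`, for differences of order `M`. -/
noncomputable def coeffMax {d : ℕ} (φ ψ : ℝ → ℝ) (M : ℕ) (f : EuclideanSpace ℝ (Fin d) → ℝ)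
    (j : ℕ) : ℝ :=
  max (⨆ l : Set.Ici j, coeffSup φ ψ f l)
    (((2 : ℝ) ^ (j * M))⁻¹ * ⨆ l : Set.Iic j, (2 : ℝ) ^ ((l : ℕ) * M) * coeffSup φ ψ f l)

theorem coeffMax_le {d M : ℕ} {φ ψ : ℝ → ℝ} {f : EuclideanSpace ℝ (Fin d) → ℝ} {j : ℕ} {A : ℝ}
    (hA : 0 ≤ A) (h1 : ∀ l, j ≤ l → coeffSup φ ψ f l ≤ A)
    (h2 : ∀ l, l ≤ j → (2 : ℝ) ^ (l * M) * coeffSup φ ψ f l ≤ 2 ^ (j * M) * A) :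
    coeffMax φ ψ M f j ≤ A := by
  refine max_le (Real.iSup_le (fun l => h1 l l.2) hA) ?_
  rw [inv_mul_le_iff₀ (by positivity)]
  exact Real.iSup_le (fun l => h2 l l.2) (by positivity)

theorem IsWaveletBasis.coeffSup_le_coeffMax {d M : ℕ} {φ ψ : ℝ → ℝ} (hw : IsWaveletBasis d M φ ψ)
    {f : EuclideanSpace ℝ (Fin d) → ℝ} {B : ℝ} (hB : ∀ x, |f x| ≤ B) {j l : ℕ} (h : j ≤ l) :
    coeffSup φ ψ f l ≤ coeffMax φ ψ M f j := by
  have hB0 : 0 ≤ B := (abs_nonneg _).trans (hB 0)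
  have hb : BddAbove (Set.range fun l : Set.Ici j => coeffSup φ ψ f l) := by
    refine ⟨B * waveletMass d φ ψ, ?_⟩
    rintro _ ⟨l, rfl⟩
    exact coeffSup_le (mul_nonneg hB0 (waveletMass_nonneg d φ ψ)) fun i k =>
      hw.abs_waveletCoeff_le hB i l k
  exact (le_ciSup hb ⟨l, h⟩).trans (le_max_left _ _)

theorem two_pow_mul_coeffSup_le_coeffMax {d : ℕ} (φ ψ : ℝ → ℝ) (M : ℕ)
    (f : EuclideanSpace ℝ (Fin d) → ℝ) {j l : ℕ} (h : l ≤ j) :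
    (2 : ℝ) ^ (l * M) * coeffSup φ ψ f l ≤ 2 ^ (j * M) * coeffMax φ ψ M f j := by
  have hb : BddAbove (Set.range fun l : Set.Iic j =>
      (2 : ℝ) ^ ((l : ℕ) * M) * coeffSup φ ψ f l) := (Set.finite_range _).bddAbove
  have h1 := le_ciSup hb ⟨l, h⟩
  have h2 : _ ≤ coeffMax φ ψ M f j := le_max_right _ _
  rw [inv_mul_le_iff₀ (by positivity)] at h2
  exact h1.trans h2

theorem coeffMax_nonneg {d : ℕ} (φ ψ : ℝ → ℝ) (M : ℕ) (f : EuclideanSpace ℝ (Fin d) → ℝ)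
    (j : ℕ) : 0 ≤ coeffMax φ ψ M f j :=
  le_max_of_le_left (Real.iSup_nonneg fun _ => coeffSup_nonneg _ _ _ _)

/-- If the maximum vanishes at one scale then all wavelet coefficients vanish, and so does the
maximum at every scale. -/
theorem IsWaveletBasis.coeffMax_eq_zero {d M : ℕ} {φ ψ : ℝ → ℝ} (hw : IsWaveletBasis d M φ ψ)
    {f : EuclideanSpace ℝ (Fin d) → ℝ} {B : ℝ} (hB : ∀ x, |f x| ≤ B) {j : ℕ}
    (h : coeffMax φ ψ M f j ≤ 0) (j' : ℕ) : coeffMax φ ψ M f j' ≤ 0 := by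
  have h0 : ∀ l, coeffSup φ ψ f l ≤ 0 := by
    intro l
    rcases le_total j l with hl | hl
    · exact (hw.coeffSup_le_coeffMax hB hl).trans h
    · have h1 := (two_pow_mul_coeffSup_le_coeffMax φ ψ M f hl).trans
        (mul_nonpos_of_nonneg_of_nonpos (by positivity) h)
      by_contra! hc
      exact absurd h1 (not_le.2 (by positivity))
  refine coeffMax_le le_rfl (fun l _ => h0 l) fun l _ => ?_
  rw [mul_zero]
  exact mul_nonpos_of_nonneg_of_nonpos (by positivity) (h0 l)

/-! ### Irregularity and lower bounds for the wavelet coefficients -/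

theorem one_le_diffOrder (α : ℝ) : 1 ≤ diffOrder α := Nat.le_add_left _ _

theorem two_rpow_neg_natCast_mul (j : ℕ) (α : ℝ) :
    (2 : ℝ) ^ (-(j : ℝ) * α) = (((2 : ℝ) ^ j)⁻¹) ^ α := by
  rw [Real.rpow_mul (by norm_num), Real.rpow_neg (by norm_num), Real.rpow_natCast]

theorem IsWaveletBasis.exists_coeffMax_le {d M : ℕ} (hd : 1 ≤ d) {φ ψ : ℝ → ℝ}
    (hw : IsWaveletBasis d M φ ψ) :
    ∃ C, 0 ≤ C ∧ ∀ (f : EuclideanSpace ℝ (Fin d) → ℝ) (B : ℝ), AEStronglyMeasurable f →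
      (∀ x, |f x| ≤ B) → ∀ j, coeffSup φ ψ f j ≤ C * modulusOfSmoothness M f ((2 : ℝ) ^ j)⁻¹ ∧
        coeffMax φ ψ M f j ≤ C * modulusOfSmoothness M f ((2 : ℝ) ^ j)⁻¹ := by
  obtain ⟨C, hC0, hC⟩ := hw.exists_abs_waveletCoeff_le hd
  refine ⟨C, hC0, fun f B hf hB j => ?_⟩
  have hω : ∀ r, 0 ≤ C * modulusOfSmoothness M f r := fun r =>
    mul_nonneg hC0 (modulusOfSmoothness_nonneg f M r)
  have hs : ∀ l, coeffSup φ ψ f l ≤ C * modulusOfSmoothness M f ((2 : ℝ) ^ l)⁻¹ := fun l =>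
    coeffSup_le (hω _) fun i k => hC f B hf hB i l k
  refine ⟨hs j, coeffMax_le (hω _) (fun l hl => (hs l).trans ?_) fun l hl => ?_⟩
  · refine mul_le_mul_of_nonneg_left (modulusOfSmoothness_mono hB M ?_) hC0
    gcongr
    norm_num
  · obtain ⟨n, rfl⟩ := Nat.exists_eq_add_of_le hl
    have h1 := modulusOfSmoothness_two_pow_mul_le hB M n ((2 : ℝ) ^ (l + n))⁻¹
    have e : (2 : ℝ) ^ n * ((2 : ℝ) ^ (l + n))⁻¹ = ((2 : ℝ) ^ l)⁻¹ := by
      rw [pow_add]; field_simp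
    rw [e] at h1
    calc _ ≤ (2 : ℝ) ^ (l * M) * (C * (2 ^ (n * M) *
          modulusOfSmoothness M f ((2 : ℝ) ^ (l + n))⁻¹)) := by
          gcongr
          exact (hs l).trans (by gcongr)
      _ = _ := by rw [add_mul, pow_add]; ring

theorem memUI_of_waveletLowerBound {d : ℕ} (hd : 1 ≤ d) {α : ℝ} (hα : 0 < α) {φ ψ : ℝ → ℝ}
    (hw : IsWaveletBasis d (diffOrder α) φ ψ) {f : EuclideanSpace ℝ (Fin d) → ℝ} {B : ℝ}
    (hf : AEStronglyMeasurable f) (hB : ∀ x, |f x| ≤ B) (h : WaveletLowerBound α φ ψ f) :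
    MemUI α 0 f := by
  obtain ⟨c, hc, hlow⟩ := h
  obtain ⟨C, hC0, hC⟩ := hw.exists_coeffMax_le hd
  refine ⟨c / (C + 1) * (2⁻¹) ^ α, by positivity, 1, one_pos, fun r hr hr1 => ?_⟩
  rw [Real.rpow_zero, mul_one]
  obtain ⟨j, hj1, hj2⟩ := exists_nat_pow_near_of_lt_one hr hr1
    (by norm_num : (0 : ℝ) < 2⁻¹) (by norm_num)
  have h1 : c * (((2 : ℝ) ^ (j + 1))⁻¹) ^ α
      ≤ (C + 1) * modulusOfSmoothness (diffOrder α) f ((2 : ℝ) ^ (j + 1))⁻¹ := by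
    rw [← two_rpow_neg_natCast_mul]
    refine (hlow (j + 1)).trans (((hC f B hf hB (j + 1)).2).trans ?_)
    gcongr
    · exact modulusOfSmoothness_nonneg _ _ _
    · linarith
  have h2 : modulusOfSmoothness (diffOrder α) f ((2 : ℝ) ^ (j + 1))⁻¹
      ≤ modulusOfSmoothness (diffOrder α) f r :=
    modulusOfSmoothness_mono hB _ (by rw [← inv_pow]; exact hj1.le)
  refine le_trans ?_ h2
  have h3 : (2⁻¹ : ℝ) ^ α * r ^ α ≤ (((2 : ℝ) ^ (j + 1))⁻¹) ^ α := by
    rw [← Real.mul_rpow (by norm_num) hr.le]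
    refine Real.rpow_le_rpow (by positivity) ?_ hα.le
    rw [← inv_pow, pow_succ, mul_comm]
    gcongr
  calc _ = c * ((2⁻¹ : ℝ) ^ α * r ^ α) / (C + 1) := by ring
    _ ≤ c * (((2 : ℝ) ^ (j + 1))⁻¹) ^ α / (C + 1) := by gcongr
    _ ≤ _ := by rwa [div_le_iff₀' (by positivity)]

/-- The wavelet coefficients of a bounded uniformly Hölder function decay geometrically. -/
theorem IsWaveletBasis.exists_coeffSup_le_of_isUniformlyHolder {d M : ℕ} (hd : 1 ≤ d) (hM : 1 ≤ M)
    {φ ψ : ℝ → ℝ} (hw : IsWaveletBasis d M φ ψ) {f : EuclideanSpace ℝ (Fin d) → ℝ} {B : ℝ}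
    (hB : ∀ x, |f x| ≤ B) (hf : AEStronglyMeasurable f) {t K : ℝ} (ht : 0 < t)
    (hK : ∀ h x, |fwdDiff h f x| ≤ K * ‖h‖ ^ t) :
    ∃ K', 0 ≤ K' ∧ ∀ j : ℕ, coeffSup φ ψ f j ≤ K' * ((2 : ℝ) ^ (-t)) ^ j := by
  obtain ⟨C, hC0, hC⟩ := hw.exists_coeffMax_le hd
  obtain ⟨n, rfl⟩ := Nat.exists_eq_add_of_le' hM
  refine ⟨C * (2 ^ n * |K|), by positivity, fun j => ((hC f B hf hB j).1).trans ?_⟩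
  rw [mul_assoc]
  refine mul_le_mul_of_nonneg_left (modulusOfSmoothness_le (by positivity) fun h hh x => ?_) hC0
  have e : ((2 : ℝ) ^ (-t)) ^ j = (((2 : ℝ) ^ j)⁻¹) ^ t := by
    rw [← two_rpow_neg_natCast_mul, ← Real.rpow_natCast, ← Real.rpow_mul (by norm_num)]
    congr 1
    ring
  rw [Function.iterate_succ_apply, mul_assoc, e]
  refine abs_fwdDiff_iter_le (fun x => (hK h x).trans ?_) h n x
  gcongr
  exact le_abs_self K

/-- The modulus of smoothness at `2^{-j}` is at most `j` times the maximum of the wavelet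
coefficients, up to a term of order `2^{-jα}`: scales beyond a multiple of `j` are negligible by
the Hölder condition, and each of the remaining ones contributes at most the maximum. -/
theorem IsWaveletBasis.exists_modulusOfSmoothness_le_coeffMax {d : ℕ} (hd : 1 ≤ d) {α : ℝ}
    (hα : 0 < α) {φ ψ : ℝ → ℝ} (hw : IsWaveletBasis d (diffOrder α) φ ψ)
    {f : EuclideanSpace ℝ (Fin d) → ℝ} {B : ℝ} (hB : ∀ x, |f x| ≤ B)
    (hf : AEStronglyMeasurable f) (hu : IsUniformlyHolder f) :
    ∃ C, 0 ≤ C ∧ ∀ j : ℕ, modulusOfSmoothness (diffOrder α) f ((2 : ℝ) ^ j)⁻¹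
      ≤ C * ((((2 : ℝ) ^ j)⁻¹) ^ α + j * coeffMax φ ψ (diffOrder α) f j) := by
  set M := diffOrder α with hM
  obtain ⟨t, ht, K, hK⟩ := hu.exists_fwdDiff_le hB
  have hB0 : 0 ≤ B := (abs_nonneg _).trans (hB 0)
  have hfc : Continuous f := by
    refine continuous_iff_continuousAt.2 fun x => ?_
    have h1 : Filter.Tendsto (fun y => K * ‖y - x‖ ^ t) (nhds x) (nhds (K * ‖x - x‖ ^ t)) := by
      refine Filter.Tendsto.const_mul _ (Filter.Tendsto.rpow_const ?_ (Or.inr ht.le))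
      exact (continuous_id.sub continuous_const).norm.tendsto x
    rw [sub_self, norm_zero, Real.zero_rpow ht.ne', mul_zero] at h1
    rw [ContinuousAt, tendsto_iff_dist_tendsto_zero]
    refine squeeze_zero (fun y => dist_nonneg) (fun y => ?_) h1
    have := hK (y - x) x
    simpa [fwdDiff, Real.dist_eq] using this
  obtain ⟨K', hK'0, hK'⟩ := hw.exists_coeffSup_le_of_isUniformlyHolder hd (one_le_diffOrder α) hB hf
    ht hK
  obtain ⟨C, hC0, hC⟩ := hw.exists_modulusOfSmoothness_le hd (one_le_diffOrder α)
  -- half of the geometric decay makes the tail small, the other half sums it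
  set s : ℝ := (2 : ℝ) ^ (-(t / 2)) with hs
  have hs0 : 0 < s := by positivity
  have hs1 : s < 1 := Real.rpow_lt_one_of_one_lt_of_neg (by norm_num) (by linarith)
  have hss : (2 : ℝ) ^ (-t) = s * s := by
    rw [hs, ← Real.rpow_add (by norm_num)]
    congr 1
    ring
  set A : ℕ := ⌈2 * α / t⌉₊ with hA
  have hAt : α ≤ t / 2 * A := by
    have := Nat.le_ceil (2 * α / t)
    rw [div_le_iff₀ ht] at this
    linarith
  have hsum := hasSum_geometric_of_lt_one hs0.le hs1
  have h1s : 0 < (1 - s)⁻¹ := inv_pos.2 (by linarith)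
  refine ⟨C * (B + K' * (1 - s)⁻¹ + A), by positivity, fun j => ?_⟩
  set X := coeffMax φ ψ M f j with hX
  have hX0 : 0 ≤ X := coeffMax_nonneg _ _ _ _ _
  set r : ℝ := ((2 : ℝ) ^ j)⁻¹ with hr
  have hr0 : 0 < r := by positivity
  have hr1 : r ≤ 1 := inv_le_one_of_one_le₀ (one_le_pow₀ (by norm_num))
  set L := A * j with hL
  have hsL : s ^ L ≤ r ^ α := by
    rw [hr, ← two_rpow_neg_natCast_mul, hs, ← Real.rpow_natCast, ← Real.rpow_mul (by norm_num)]
    refine Real.rpow_le_rpow_of_exponent_le (by norm_num) ?_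
    rw [hL]
    push_cast
    have : (0 : ℝ) ≤ j := by positivity
    nlinarith
  set a : ℕ → ℝ := fun l => coeffSup φ ψ f l * min 1 ((2 ^ l * r) ^ M) with ha
  have ha0 : ∀ l, 0 ≤ a l := fun l => mul_nonneg (coeffSup_nonneg _ _ _ _) (by positivity)
  have haX : ∀ l, a l ≤ X := by
    intro l
    rcases le_total j l with hl | hl
    · calc a l ≤ coeffSup φ ψ f l * 1 :=
            mul_le_mul_of_nonneg_left (min_le_left _ _) (coeffSup_nonneg _ _ _ _)
        _ ≤ X := by
            rw [mul_one]
            exact hw.coeffSup_le_coeffMax hB hl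
    · calc a l ≤ coeffSup φ ψ f l * (2 ^ l * r) ^ M :=
            mul_le_mul_of_nonneg_left (min_le_right _ _) (coeffSup_nonneg _ _ _ _)
        _ = (2 ^ (j * M))⁻¹ * (2 ^ (l * M) * coeffSup φ ψ f l) := by
            rw [hr, mul_pow, inv_pow, ← pow_mul, ← pow_mul]
            ring
        _ ≤ X := by
            rw [inv_mul_le_iff₀ (by positivity)]
            exact two_pow_mul_coeffSup_le_coeffMax φ ψ M f hl
  have haK : ∀ l, a l ≤ K' * (s ^ l * s ^ l) := fun l => by
    calc a l ≤ coeffSup φ ψ f l * 1 :=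
          mul_le_mul_of_nonneg_left (min_le_left _ _) (coeffSup_nonneg _ _ _ _)
      _ ≤ _ := by
          rw [mul_one, ← mul_pow, ← hss]
          exact hK' l
  set b : ℕ → ℝ := fun l => (if l ∈ Finset.range L then X else 0) + K' * s ^ L * s ^ l with hb
  have hab : ∀ l, a l ≤ b l := by
    intro l
    by_cases hl : l ∈ Finset.range L
    · simp only [hb, hl, if_true]
      have := haX l
      have : 0 ≤ K' * s ^ L * s ^ l := by positivity
      linarith
    · simp only [hb, hl, if_false, zero_add]
      refine (haK l).trans ?_
      rw [mul_assoc]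
      gcongr K' * (?_ * s ^ l)
      exact pow_le_pow_of_le_one hs0.le hs1.le (by simpa using hl)
  have hbsum : HasSum b (L * X + K' * s ^ L * (1 - s)⁻¹) := by
    refine HasSum.add ?_ (hsum.mul_left _)
    have := hasSum_sum_of_ne_finset_zero (f := fun l => if l ∈ Finset.range L then X else 0)
      (s := Finset.range L) (L := SummationFilter.unconditional ℕ) fun l hl => by simp [hl]
    rwa [Finset.sum_ite_mem, Finset.inter_self, Finset.sum_const, Finset.card_range,
      nsmul_eq_mul] at this
  have hasum : Summable a := Summable.of_nonneg_of_le ha0 hab hbsum.summable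
  have htsum : ∑' l, a l ≤ L * X + K' * s ^ L * (1 - s)⁻¹ := by
    rw [← hbsum.tsum_eq]
    exact hasum.tsum_le_tsum hab hbsum.summable
  have hrM : r ^ M ≤ r ^ α := by
    rw [← Real.rpow_natCast]
    refine Real.rpow_le_rpow_of_exponent_ge hr0 hr1 ?_
    rw [hM, diffOrder]
    push_cast
    exact (Nat.lt_floor_add_one α).le
  have hra : 0 ≤ r ^ α := by positivity
  have hω := hC f B hfc hB (coeffSup φ ψ f)
    (fun i j k => hw.abs_waveletCoeff_le_coeffSup hB i j k) r hr0 hasum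
  refine hω.trans ?_
  rw [mul_assoc]
  refine mul_le_mul_of_nonneg_left ?_ hC0
  have hLX : (L : ℝ) * X = A * (j * X) := by
    rw [hL]; push_cast; ring
  have h1 : B * r ^ M ≤ B * r ^ α := by gcongr
  have h2 : K' * s ^ L * (1 - s)⁻¹ ≤ K' * (1 - s)⁻¹ * r ^ α := by
    calc _ = K' * (1 - s)⁻¹ * s ^ L := by ring
      _ ≤ _ := by gcongr
  have h3 : 0 ≤ (B + K' * (1 - s)⁻¹) * (j * X) := by positivity
  have h4 : 0 ≤ (A : ℝ) * r ^ α := by positivity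
  calc _ ≤ B * r ^ α + (A * (j * X) + K' * (1 - s)⁻¹ * r ^ α) := by
        rw [← hLX]
        exact add_le_add h1 (htsum.trans (by linarith))
    _ ≤ _ := by linarith

theorem exists_pos_le_of_forall_pos {a : ℕ → ℝ} (ha : ∀ j, 0 < a j) (J : ℕ) :
    ∃ c > 0, ∀ j < J, c ≤ a j := by
  induction J with
  | zero => exact ⟨1, one_pos, by simp⟩
  | succ J ih =>
    obtain ⟨c, hc, h⟩ := ih
    refine ⟨min c (a J), lt_min hc (ha J), fun j hj => ?_⟩
    rcases Nat.lt_succ_iff_lt_or_eq.1 hj with hj | rfl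
    · exact (min_le_left _ _).trans (h j hj)
    · exact min_le_right _ _

theorem waveletLowerBound_of_memUI {d : ℕ} (hd : 1 ≤ d) {α : ℝ} (hα : 0 < α) {φ ψ : ℝ → ℝ}
    (hw : IsWaveletBasis d (diffOrder α) φ ψ) {f : EuclideanSpace ℝ (Fin d) → ℝ} {B : ℝ}
    (hf : AEStronglyMeasurable f) (hB : ∀ x, |f x| ≤ B) (hu : IsUniformlyHolder f)
    (hUI : ∀ β : ℝ, 1 < β → MemUI α β f) : WaveletLowerBound α φ ψ f := by
  obtain ⟨C, hC0, hC⟩ := hw.exists_modulusOfSmoothness_le_coeffMax hd hα hB hf hu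
  -- any exponent larger than one beats the number of scales that contribute
  obtain ⟨c, hc, R, hR, hlow⟩ := hUI 2 (by norm_num)
  have hlog : 0 < Real.log 2 := Real.log_pos (by norm_num)
  have hlarge : ∃ J : ℕ, ∀ j, J ≤ j →
      (((2 : ℝ) ^ j)⁻¹) ^ α ≤ coeffMax φ ψ (diffOrder α) f j := by
    obtain ⟨J₁, hJ₁⟩ := exists_pow_lt_of_lt_one hR (by norm_num : (2⁻¹ : ℝ) < 1)
    obtain ⟨J₂, hJ₂⟩ := exists_nat_gt (C * 2 / (c * Real.log 2 ^ 2))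
    refine ⟨max (max J₁ J₂) 1, fun j hj => ?_⟩
    have hj1 : J₁ ≤ j := (le_max_left _ _).trans ((le_max_left _ _).trans hj)
    have hj2 : J₂ ≤ j := (le_max_right _ _).trans ((le_max_left _ _).trans hj)
    have hj3 : (1 : ℝ) ≤ j := by exact_mod_cast (le_max_right _ _).trans hj
    by_contra! hX
    have hr0 : (0 : ℝ) < ((2 : ℝ) ^ j)⁻¹ := by positivity
    have hrR : ((2 : ℝ) ^ j)⁻¹ ≤ R := by
      rw [← inv_pow]
      exact (pow_le_pow_of_le_one (by norm_num) (by norm_num) hj1).trans hJ₁.le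
    have h1 := (hlow _ hr0 hrR).trans (hC j)
    have e : |Real.log ((2 : ℝ) ^ j)⁻¹| ^ (2 : ℝ) = j ^ 2 * Real.log 2 ^ 2 := by
      rw [Real.log_inv, Real.log_pow, abs_neg, abs_of_nonneg (by positivity),
        show (2 : ℝ) = ((2 : ℕ) : ℝ) by norm_num, Real.rpow_natCast, mul_pow]
    rw [e] at h1
    set ρ := (((2 : ℝ) ^ j)⁻¹) ^ α with hρ
    have hρ0 : 0 < ρ := by positivity
    have h2 : ρ + j * coeffMax φ ψ (diffOrder α) f j ≤ 2 * j * ρ := by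
      have : (j : ℝ) * coeffMax φ ψ (diffOrder α) f j ≤ j * ρ := by gcongr
      have : 1 * ρ ≤ j * ρ := by gcongr
      linarith
    have h3 : c * ρ * (j ^ 2 * Real.log 2 ^ 2) ≤ C * (2 * j * ρ) := h1.trans (by gcongr)
    have h4 : (c * Real.log 2 ^ 2 * j) * (j * ρ) ≤ (C * 2) * (j * ρ) := by linarith
    have h5 := le_of_mul_le_mul_right h4 (by positivity)
    have h6 : (C * 2 / (c * Real.log 2 ^ 2)) < j := hJ₂.trans_le (by exact_mod_cast hj2)
    rw [div_lt_iff₀ (by positivity)] at h6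
    linarith
  obtain ⟨J, hJ⟩ := hlarge
  have hpos : ∀ j, 0 < coeffMax φ ψ (diffOrder α) f j := by
    intro j
    by_contra! h
    have h1 := (hJ J le_rfl).trans (hw.coeffMax_eq_zero hB h J)
    exact absurd h1 (not_le.2 (by positivity))
  obtain ⟨c', hc', hsmall⟩ := exists_pos_le_of_forall_pos
    (a := fun j => coeffMax φ ψ (diffOrder α) f j / (((2 : ℝ) ^ j)⁻¹) ^ α)
    (fun j => div_pos (hpos j) (by positivity)) J
  refine ⟨min c' 1, lt_min hc' one_pos, fun j => ?_⟩
  rw [two_rpow_neg_natCast_mul]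
  change _ ≤ coeffMax φ ψ (diffOrder α) f j
  have hρ0 : (0 : ℝ) < (((2 : ℝ) ^ j)⁻¹) ^ α := by positivity
  rcases lt_or_ge j J with hj | hj
  · have := hsmall j hj
    rw [le_div_iff₀ hρ0] at this
    exact (mul_le_mul_of_nonneg_right (min_le_left _ _) hρ0.le).trans this
  · exact (mul_le_of_le_one_left hρ0.le (min_le_right _ _)).trans (hJ j hj)

theorem theorem3 {d : ℕ} (hd : 1 ≤ d) {α : ℝ} (hα : 0 < α) {φ ψ : ℝ → ℝ}
    (hw : IsWaveletBasis d (diffOrder α) φ ψ)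
    {f : EuclideanSpace ℝ (Fin d) → ℝ} (hf : AEMeasurable f volume)
    (hbdd : ∃ B : ℝ, ∀ x, |f x| ≤ B) :
    (WaveletLowerBound α φ ψ f → MemUI α 0 f) ∧
      (IsUniformlyHolder f → (∀ β : ℝ, 1 < β → MemUI α β f) → WaveletLowerBound α φ ψ f) := by
  obtain ⟨B, hB⟩ := hbdd
  exact ⟨memUI_of_waveletLowerBound hd hα hw hf.aestronglyMeasurable hB,
    waveletLowerBound_of_memUI hd hα hw hf.aestronglyMeasurable hB⟩
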